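/- Let $n\ge 0$ be an integer and consider the vertex superalgebra generated by $n$ symplectic boson pairs $(X_i,Y_i)$, Heisenberg currents $h_a$ and ghosts $(b_a,c^a)$, $1\le a\le n-1$, realized on the vacuum Fock space, with $$X_i(z)Y_j(0)\sim\frac{\delta_{ij}}{z},\qquad h_a(z)h_b(0)\sim\frac{C_{ab}}{z^2},\qquad b_a(z)c^b(0)\sim\frac{\delta_a^b}{z},$$ all other OPEs of generators being regular, where $C$ is the Cartan matrix of $\mathfrak{su}(n)$ and $C^{ab}$ are the entries of $C^{-1}$. Products of fields denote nested normally ordered products, $(AB)$ is the normally ordered product, and $A\mapsto QA$ is the action of the BRST charge $$Q=\oint\frac{dz}{2\pi i}\sum_{a=1}^{n-1}c^a\left(X_aY_a-X_{a+1}Y_{a+1}+h_a\right).$$ Write $A\equiv B$ if $A-B$ is $Q$-exact. The stress tensor is $$T=\frac12\sum_{i=1}^n\left(X_i\partial Y_i-\partial X_i\,Y_i\right)+\frac12\sum_{a,b=1}^{n-1}C^{ab}h_ah_b-\sum_{a=1}^{n-1}b_a\partial c^a .$$ Put $\mathcal A_i=-X_iY_i$ and, for an operator $\mathcal O$, $D_i\mathcal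 O=2(\mathcal A_i\mathcal O)+(X_i(Y_i\mathcal O))$, and let $\mathcal X=X_1\cdots X_n$, $\mathcal Y=Y_1\cdots Y_n$. Let $k\ge 0$ with $2k\le n$, let $i_1,\dots,i_{2k}\in\{1,\dots,n\}$ be distinct, and let $P$ be either of $$\prod_{j=1}^{k}\left(D_{i_{2j-1}}-D_{i_{2j}}\right)\mathcal X,\qquad \prod_{j=1}^{k}\left(D_{i_{2j-1}}-D_{i_{2j}}\right)\mathcal Y .$$ Then $P$ is primary of weight $\frac n2+k$ for $T$: $$T(z)P(0)\sim\frac{\left(\frac n2+k\right)P}{z^2}+\frac{\partial P}{z},$$ with no poles of order three or higher. Moreover $QP=0$, and the BRST class of $P$ is primary of the same weight for the class of $T$: for every even operator $T'\equiv T$ of the vertex superalgebra, the same OPE holds with $T'$ in place of $T$, modulo $Q$-exact operators in each coefficient. -/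

import Mathlib

open scoped TensorProduct

namespace BosonicVOA

/-! ## Fields on a complex vector space and their products

A field `A(z) = ∑ₘ A₍ₘ₎ z^(-m-1)` on `V` is a `VertexOperator ℂ V`; its mode `A₍ₘ₎` is
`VertexOperator.ncoeff A m`. -/

section Fields

variable {V : Type*} [AddCommGroup V] [Module ℂ V]

/-- The mode `A₍ₘ₎`. -/
noncomputable abbrev mode (A : VertexOperator ℂ V) (m : ℤ) : Module.End ℂ V :=
  VertexOperator.ncoeff A m

/-- The field with prescribed modes `f m`, where each vector is killed by `f m` for large `m`. -/
noncomputable def ofModes (f : ℤ → Module.End ℂ V)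
    (hf : ∀ v, ∃ N : ℤ, ∀ m, N ≤ m → f m v = 0) : VertexOperator ℂ V :=
  VertexOperator.of_coeff (fun y => f (-y - 1)) (by
    intro v
    obtain ⟨N, hN⟩ := hf v
    refine ⟨-N, fun y hy => ?_⟩
    by_contra h
    exact hy (hN _ (by omega)))

theorem mode_ofModes (f : ℤ → Module.End ℂ V)
    (hf : ∀ v, ∃ N : ℤ, ∀ m, N ≤ m → f m v = 0) (m : ℤ) : mode (ofModes f hf) m = f m := by
  simp [mode, ofModes]

theorem exists_mode_eq_zero (A : VertexOperator ℂ V) (v : V) :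
    ∃ N : ℕ, ∀ m : ℤ, (N : ℤ) ≤ m → mode A m v = 0 := by
  refine ⟨(-((HahnModule.of ℂ).symm (A v)).order).toNat, fun m hm => ?_⟩
  apply VertexOperator.ncoeff_eq_zero_of_lt_order
  have := Int.self_le_toNat (-((HahnModule.of ℂ).symm (A v)).order)
  omega

/-- The Koszul sign `(-1)^(pq)` of two parities. -/
def koszul (p q : ZMod 2) : ℤ := (-1) ^ (p.val * q.val)

/-- The `j`-th summand of the `m`-th mode of the residue product `A₍ₙ₎B`. -/
noncomputable def prodTerm (ε : ℤ) (A B : VertexOperator ℂ V) (n m : ℤ) (j : ℕ) :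
    Module.End ℂ V :=
  ((-1) ^ j * Ring.choose n j : ℤ) •
    (mode A (n - j) * mode B (m + j) -
      (ε * (n.negOnePow : ℤ)) • (mode B (m + n - j) * mode A j))

theorem finite_support_prodTerm (ε : ℤ) (A B : VertexOperator ℂ V) (n m : ℤ) (v : V) :
    (Function.support fun j => prodTerm ε A B n m j v).Finite := by
  obtain ⟨N₁, h₁⟩ := exists_mode_eq_zero A v
  obtain ⟨N₂, h₂⟩ := exists_mode_eq_zero B v
  refine (Set.finite_Iio (max N₁ (N₂ + m.natAbs))).subset fun j hj => ?_
  by_contra h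
  simp only [Set.mem_Iio, not_lt] at h
  exact hj (by simp [prodTerm, h₁ j (by omega), h₂ (m + j) (by omega)])

/-- The `m`-th mode of the residue product. -/
noncomputable def prodMode (ε : ℤ) (A B : VertexOperator ℂ V) (n m : ℤ) : Module.End ℂ V where
  toFun v := ∑ᶠ j : ℕ, prodTerm ε A B n m j v
  map_add' v w := by
    simp only [map_add]
    exact finsum_add_distrib (finite_support_prodTerm ε A B n m v)
      (finite_support_prodTerm ε A B n m w)
  map_smul' c v := by
    simp only [map_smul, RingHom.id_apply]
    exact (smul_finsum' c (finite_support_prodTerm ε A B n m v)).symm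

theorem prodMode_eq_zero (ε : ℤ) (A B : VertexOperator ℂ V) (n : ℤ) (v : V) :
    ∃ N : ℤ, ∀ m, N ≤ m → prodMode ε A B n m v = 0 := by
  obtain ⟨N₁, h₁⟩ := exists_mode_eq_zero A v
  obtain ⟨N₂, h₂⟩ := exists_mode_eq_zero B v
  choose K hK using fun j : ℕ => exists_mode_eq_zero B (mode A j v)
  refine ⟨N₂ + N₁ + n.natAbs + ∑ j ∈ Finset.range N₁, K j, fun m hm => ?_⟩
  change ∑ᶠ j : ℕ, prodTerm ε A B n m j v = 0
  rw [← finsum_zero (α := ℕ)]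
  congr 1
  funext j
  have hs : (0 : ℤ) ≤ ∑ j ∈ Finset.range N₁, (K j : ℤ) :=
    Finset.sum_nonneg fun _ _ => by positivity
  have hn := neg_abs_le n
  have hn' := abs_nonneg n
  have hB : mode B (m + j) v = 0 := h₂ _ (by push_cast at hm; omega)
  by_cases hj : j < N₁
  · have hk : (K j : ℤ) ≤ ∑ j ∈ Finset.range N₁, (K j : ℤ) :=
      Finset.single_le_sum (f := fun j => (K j : ℤ)) (fun _ _ => by positivity)
        (Finset.mem_range.2 hj)
    have := hK j (m + n - j) (by push_cast at hm; omega)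
    simp [prodTerm, hB, this]
  · simp [prodTerm, hB, h₁ j (by omega)]

/-- The residue product of fields of parities `p` and `q`:
`(A₍ₙ₎B)(w) = Res_z ( A(z)B(w) (z-w)ⁿ|_{|z|>|w|} - (-1)^(pq) B(w)A(z) (z-w)ⁿ|_{|w|>|z|} )`,
that is, the contour integral `∮ dz/(2πi) (z-w)ⁿ A(z)B(w)` around `w`. The field `A₍ⱼ₎B`, `j ≥ 0`,
is the coefficient of `(z-w)^(-j-1)` in the OPE of `A(z)` with `B(w)`, and `A₍₋₁₎B` is the normally
ordered product. -/
noncomputable def nprod (p q : ZMod 2) (n : ℤ) (A B : VertexOperator ℂ V) : VertexOperator ℂ V :=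
  ofModes (prodMode (koszul p q) A B n) (prodMode_eq_zero (koszul p q) A B n)

/-- The normally ordered product `(AB)` of two fields of parities `p` and `q`. -/
noncomputable abbrev normal (p q : ZMod 2) (A B : VertexOperator ℂ V) : VertexOperator ℂ V :=
  nprod p q (-1) A B

/-- The derivative `∂A`. -/
noncomputable def deriv (A : VertexOperator ℂ V) : VertexOperator ℂ V :=
  ofModes (fun m => (-m) • mode A (m - 1)) (by
    intro v
    obtain ⟨N, hN⟩ := exists_mode_eq_zero A v
    exact ⟨N + 1, fun m hm => by simp [hN (m - 1) (by omega)]⟩)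

/-- The identity field. -/
noncomputable def oneField (V : Type*) [AddCommGroup V] [Module ℂ V] : VertexOperator ℂ V :=
  ofModes (fun m => if m = -1 then 1 else 0) (by
    intro v
    exact ⟨0, fun m hm => by simp [show m ≠ -1 by omega]⟩)

/-- The field with modes `ann r` for `m = r ≥ 0` and `cre r` for `m = -1-r < 0`. -/
noncomputable def freeField (cre ann : ℕ → Module.End ℂ V)
    (h : ∀ v, ∃ N : ℕ, ∀ r, N ≤ r → ann r v = 0) : VertexOperator ℂ V :=
  ofModes (fun m => match m with
    | Int.ofNat r => ann r
    | Int.negSucc r => cre r) (by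
    intro v
    obtain ⟨N, hN⟩ := h v
    refine ⟨N, fun m hm => ?_⟩
    match m, hm with
    | Int.ofNat r, hm => exact hN r (by simpa using hm)
    | Int.negSucc r, hm => omega)

end Fields

/-! ## The Fock space of the symplectic bosons, the Heisenberg currents and the ghosts -/

/-- Bosonic creation operators: `X_{i,(-1-r)}`, `Y_{i,(-1-r)}` and `h_{a,(-1-r)}`. -/
inductive BosMode (n : ℕ) : Type
  | X (i : Fin n) (r : ℕ)
  | Y (i : Fin n) (r : ℕ)
  | h (a : Fin (n - 1)) (r : ℕ)

/-- Fermionic creation operators: `b_{a,(-1-r)}` and `c^a_{(-1-r)}`. -/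
inductive FerMode (n : ℕ) : Type
  | b (a : Fin (n - 1)) (r : ℕ)
  | c (a : Fin (n - 1)) (r : ℕ)

/-- Polynomials in the bosonic creation operators tensored with the exterior algebra on the
fermionic ones; the vacuum is `1 ⊗ 1`. -/
abbrev Fock (n : ℕ) : Type :=
  MvPolynomial (BosMode n) ℂ ⊗[ℂ] ExteriorAlgebra ℂ (FerMode n →₀ ℂ)

section Modes

variable {n : ℕ}

/-- Multiplication by the variable `s`. -/
noncomputable def bosCre (s : BosMode n) : Module.End ℂ (Fock n) :=
  LinearMap.rTensor _ (LinearMap.mulLeft ℂ (MvPolynomial.X s))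

/-- The partial derivative with respect to the variable `s`. -/
noncomputable def bosAnn (s : BosMode n) : Module.End ℂ (Fock n) :=
  LinearMap.rTensor _ (MvPolynomial.pderiv s).toLinearMap

/-- Exterior multiplication by the generator `s`. -/
noncomputable def ferCre (s : FerMode n) : Module.End ℂ (Fock n) :=
  LinearMap.lTensor _
    (LinearMap.mulLeft ℂ (ExteriorAlgebra.ι ℂ (Finsupp.single s (1 : ℂ))))

/-- Contraction with the dual of the generator `s`. -/
noncomputable def ferAnn (s : FerMode n) : Module.End ℂ (Fock n) :=
  LinearMap.lTensor _
    (CliffordAlgebra.contractLeft (Q := (0 : QuadraticForm ℂ (FerMode n →₀ ℂ)))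
      (Finsupp.lapply s : (FerMode n →₀ ℂ) →ₗ[ℂ] ℂ))

theorem eventually_bosAnn (s : ℕ → BosMode n) (hs : Function.Injective s) (v : Fock n) :
    ∃ N : ℕ, ∀ r, N ≤ r → bosAnn (s r) v = 0 := by
  induction v using TensorProduct.induction_on with
  | zero => exact ⟨0, fun r _ => map_zero _⟩
  | tmul f x =>
    have hfin : (s ⁻¹' (f.vars : Set (BosMode n))).Finite :=
      f.vars.finite_toSet.preimage hs.injOn
    obtain ⟨N, hN⟩ := hfin.bddAbove
    refine ⟨N + 1, fun r hr => ?_⟩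
    have : s r ∉ f.vars := fun h => by
      have := hN (show r ∈ s ⁻¹' (f.vars : Set (BosMode n)) from h)
      omega
    simp [bosAnn, MvPolynomial.pderiv_eq_zero_of_notMem_vars this]
  | add v w hv hw =>
    obtain ⟨N, hN⟩ := hv
    obtain ⟨M, hM⟩ := hw
    exact ⟨max N M, fun r hr => by
      rw [map_add, hN r (by omega), hM r (by omega), add_zero]⟩

theorem eventually_ferAnn (s : ℕ → FerMode n) (hs : Function.Injective s) (v : Fock n) :
    ∃ N : ℕ, ∀ r, N ≤ r → ferAnn (s r) v = 0 := by
  induction v using TensorProduct.induction_on with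
  | zero => exact ⟨0, fun r _ => map_zero _⟩
  | tmul f x =>
    suffices h : ∃ N : ℕ, ∀ r, N ≤ r →
        CliffordAlgebra.contractLeft (Q := (0 : QuadraticForm ℂ (FerMode n →₀ ℂ)))
          (Finsupp.lapply (s r) : (FerMode n →₀ ℂ) →ₗ[ℂ] ℂ) x = 0 by
      obtain ⟨N, hN⟩ := h
      exact ⟨N, fun r hr => by
        rw [ferAnn, LinearMap.lTensor_tmul, hN r hr, TensorProduct.tmul_zero]⟩
    induction x using CliffordAlgebra.left_induction with
    | algebraMap c => exact ⟨0, fun r _ => CliffordAlgebra.contractLeft_algebraMap _ _ _⟩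
    | add x y hx hy =>
      obtain ⟨N, hN⟩ := hx
      obtain ⟨M, hM⟩ := hy
      exact ⟨max N M, fun r hr => by
        rw [map_add, hN r (by omega), hM r (by omega), add_zero]⟩
    | ι_mul x m hx =>
      obtain ⟨N, hN⟩ := hx
      have hfin : (s ⁻¹' (m.support : Set (FerMode n))).Finite :=
        m.support.finite_toSet.preimage hs.injOn
      obtain ⟨M, hM⟩ := hfin.bddAbove
      refine ⟨max N (M + 1), fun r hr => ?_⟩
      have h0 : m (s r) = 0 := by
        by_contra h
        have := hM (show r ∈ s ⁻¹' (m.support : Set (FerMode n)) from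
          Finsupp.mem_support_iff.2 h)
        omega
      rw [CliffordAlgebra.contractLeft_ι_mul, hN r (by omega), Finsupp.lapply_apply, h0]
      simp
  | add v w hv hw =>
    obtain ⟨N, hN⟩ := hv
    obtain ⟨M, hM⟩ := hw
    exact ⟨max N M, fun r hr => by
      rw [map_add, hN r (by omega), hM r (by omega), add_zero]⟩

end Modes

/-! ## The free fields -/

/-- The Cartan matrix `C` of `su(n)`. -/
noncomputable def cartan (n : ℕ) : Matrix (Fin (n - 1)) (Fin (n - 1)) ℂ :=
  (CartanMatrix.A (n - 1)).map (fun x : ℤ => (x : ℂ))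

section FreeFields

variable {n : ℕ}

/-- `X_i(z)`, with `X_i(z) Y_j(0) ∼ δ_ij / z`. -/
noncomputable def fieldX (i : Fin n) : VertexOperator ℂ (Fock n) :=
  freeField (fun r => bosCre (.X i r)) (fun r => bosAnn (.Y i r))
    (eventually_bosAnn _ fun _ _ h => by cases h; rfl)

/-- `Y_i(z)`. -/
noncomputable def fieldY (i : Fin n) : VertexOperator ℂ (Fock n) :=
  freeField (fun r => bosCre (.Y i r)) (fun r => -bosAnn (.X i r)) (by
    intro v
    obtain ⟨N, hN⟩ := eventually_bosAnn (fun r => BosMode.X i r) (fun _ _ h => by cases h; rfl) v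
    exact ⟨N, fun r hr => by simp [hN r hr]⟩)

/-- The annihilation modes of `h_a(z)`: zero for the zero mode and
`∑_b (r+1) C_ab ∂/∂h_{b,(-1-r)}` for the mode `r+1`. -/
noncomputable def heisAnn (a : Fin (n - 1)) : ℕ → Module.End ℂ (Fock n)
  | 0 => 0
  | r + 1 => ∑ b, (((r : ℂ) + 1) * cartan n a b) • bosAnn (.h b r)

/-- `h_a(z)`, with `h_a(z) h_b(0) ∼ C_ab / z²`. -/
noncomputable def fieldH (a : Fin (n - 1)) : VertexOperator ℂ (Fock n) :=
  freeField (fun r => bosCre (.h a r)) (heisAnn a) (by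
    intro v
    choose N hN using fun b : Fin (n - 1) =>
      eventually_bosAnn (fun r => BosMode.h b r) (fun _ _ h => by cases h; rfl) v
    refine ⟨∑ b, N b + 1, fun r hr => ?_⟩
    obtain ⟨r, rfl⟩ : ∃ t, r = t + 1 := ⟨r - 1, by omega⟩
    simp only [heisAnn, LinearMap.sum_apply, LinearMap.smul_apply]
    refine Finset.sum_eq_zero fun b _ => ?_
    have := Finset.single_le_sum (f := N) (fun _ _ => Nat.zero_le _) (Finset.mem_univ b)
    rw [hN b r (by omega), smul_zero])

/-- `b_a(z)`, with `b_a(z) c^b(0) ∼ δ_a^b / z`. -/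
noncomputable def fieldB (a : Fin (n - 1)) : VertexOperator ℂ (Fock n) :=
  freeField (fun r => ferCre (.b a r)) (fun r => ferAnn (.c a r))
    (eventually_ferAnn _ fun _ _ h => by cases h; rfl)

/-- `c^a(z)`. -/
noncomputable def fieldC (a : Fin (n - 1)) : VertexOperator ℂ (Fock n) :=
  freeField (fun r => ferCre (.c a r)) (fun r => ferAnn (.b a r))
    (eventually_ferAnn _ fun _ _ h => by cases h; rfl)

/-- The vertex superalgebra generated by the free fields: `IsOperator p A` says that `A` is an
element of parity `p`. -/
inductive IsOperator : ZMod 2 → VertexOperator ℂ (Fock n) → Prop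
  | one : IsOperator 0 (oneField (Fock n))
  | X (i : Fin n) : IsOperator 0 (fieldX i)
  | Y (i : Fin n) : IsOperator 0 (fieldY i)
  | h (a : Fin (n - 1)) : IsOperator 0 (fieldH a)
  | b (a : Fin (n - 1)) : IsOperator 1 (fieldB a)
  | c (a : Fin (n - 1)) : IsOperator 1 (fieldC a)
  | zero (p : ZMod 2) : IsOperator p 0
  | add {p : ZMod 2} {A B : VertexOperator ℂ (Fock n)} :
      IsOperator p A → IsOperator p B → IsOperator p (A + B)
  | smul {p : ZMod 2} (t : ℂ) {A : VertexOperator ℂ (Fock n)} :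
      IsOperator p A → IsOperator p (t • A)
  | nprod {p q : ZMod 2} (m : ℤ) {A B : VertexOperator ℂ (Fock n)} :
      IsOperator p A → IsOperator q B → IsOperator (p + q) (nprod p q m A B)

end FreeFields

/-! ## BRST charge and stress tensor -/

/-- For a gauge node `a ∈ {1,…,n-1}`, the index `a` of the hypermultiplet on its left. -/
def left {n : ℕ} (a : Fin (n - 1)) : Fin n := ⟨a.val, by omega⟩

/-- For a gauge node `a ∈ {1,…,n-1}`, the index `a + 1` of the hypermultiplet on its right. -/
def right {n : ℕ} (a : Fin (n - 1)) : Fin n := ⟨a.val + 1, by omega⟩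

/-- `J_BRST = ∑_a c^a (X_a Y_a - X_{a+1} Y_{a+1} + h_a)`. -/
noncomputable def brstCurrent (n : ℕ) : VertexOperator ℂ (Fock n) :=
  ∑ a : Fin (n - 1), normal 1 0 (fieldC a)
    (normal 0 0 (fieldX (left a)) (fieldY (left a)) -
      normal 0 0 (fieldX (right a)) (fieldY (right a)) + fieldH a)

/-- The action of the BRST charge `Q = ∮ dz/(2πi) J_BRST(z)` on a field of parity `p`. -/
noncomputable def brst {n : ℕ} (p : ZMod 2) (A : VertexOperator ℂ (Fock n)) :
    VertexOperator ℂ (Fock n) :=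
  nprod 1 p 0 (brstCurrent n) A

/-- `A ≡ B` for operators of parity `p`: the difference is `Q`-exact. -/
def BRSTEquiv {n : ℕ} (p : ZMod 2) (A B : VertexOperator ℂ (Fock n)) : Prop :=
  ∃ C, IsOperator (p + 1) C ∧ A - B = brst (p + 1) C

/-- `T_sb = (1/2) ∑_i (X_i ∂Y_i - ∂X_i Y_i)`. -/
noncomputable def stressSB (n : ℕ) : VertexOperator ℂ (Fock n) :=
  (1 / 2 : ℂ) • ∑ i : Fin n, (normal 0 0 (fieldX i) (deriv (fieldY i)) -
    normal 0 0 (deriv (fieldX i)) (fieldY i))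

/-- `T_h = (1/2) ∑_{a,b} C^{ab} h_a h_b`, with `C^{ab}` the inverse of the Cartan matrix. -/
noncomputable def stressH (n : ℕ) : VertexOperator ℂ (Fock n) :=
  (1 / 2 : ℂ) • ∑ a : Fin (n - 1), ∑ b : Fin (n - 1),
    (cartan n)⁻¹ a b • normal 0 0 (fieldH a) (fieldH b)

/-- `T_bc = - ∑_a b_a ∂c^a`. -/
noncomputable def stressBC (n : ℕ) : VertexOperator ℂ (Fock n) :=
  -∑ a : Fin (n - 1), normal 1 1 (fieldB a) (deriv (fieldC a))

/-- The stress tensor `T = T_sb + T_h + T_bc`. -/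
noncomputable def stressTensor (n : ℕ) : VertexOperator ℂ (Fock n) :=
  stressSB n + stressH n + stressBC n

/-! ## Covariant derivatives and the operators `𝒳`, `𝒴` -/

section Operators

variable {n : ℕ}

/-- `𝒜_i = -X_i Y_i`. -/
noncomputable def gaugeA (i : Fin n) : VertexOperator ℂ (Fock n) :=
  -normal 0 0 (fieldX i) (fieldY i)

/-- `Â_i O = (𝒜_i O)` on even operators `O`. -/
noncomputable def hatA (i : Fin n) (O : VertexOperator ℂ (Fock n)) : VertexOperator ℂ (Fock n) :=
  normal 0 0 (gaugeA i) O

/-- `𝒟_i O = (𝒜_i O) + (X_i (Y_i O))` on even operators `O`. -/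
noncomputable def partialD (i : Fin n) (O : VertexOperator ℂ (Fock n)) :
    VertexOperator ℂ (Fock n) :=
  normal 0 0 (gaugeA i) O + normal 0 0 (fieldX i) (normal 0 0 (fieldY i) O)

/-- The covariant derivative `D_i = 𝒟_i + Â_i`. -/
noncomputable def covD (i : Fin n) : VertexOperator ℂ (Fock n) → VertexOperator ℂ (Fock n) :=
  fun O => partialD i O + hatA i O

/-- The nested normally ordered product `(A₁ (A₂ (⋯ Aₙ)))`. -/
noncomputable def nestedProd (A : Fin n → VertexOperator ℂ (Fock n)) : VertexOperator ℂ (Fock n) :=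
  (List.ofFn A).foldr (fun B O => normal 0 0 B O) (oneField (Fock n))

/-- `𝒳 = X₁ X₂ ⋯ Xₙ`. -/
noncomputable def calX (n : ℕ) : VertexOperator ℂ (Fock n) := nestedProd fieldX

/-- `𝒴 = Y₁ Y₂ ⋯ Yₙ`. -/
noncomputable def calY (n : ℕ) : VertexOperator ℂ (Fock n) := nestedProd fieldY

/-- `∏_{j=1}^k (D_{i_{2j-1}} - D_{i_{2j}}) O`, the factor `j = 1` being applied last.
The sequence `i` is indexed from `0`. -/
noncomputable def diffProd {k : ℕ} (i : Fin (2 * k) → Fin n) (O : VertexOperator ℂ (Fock n)) :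
    VertexOperator ℂ (Fock n) :=
  (List.ofFn fun j : Fin k =>
      covD (i ⟨2 * j.val, by omega⟩) - covD (i ⟨2 * j.val + 1, by omega⟩)).foldr
    (fun D P => D P) O

end Operators

/-! ## Primary fields -/

/-- The even field `O` is primary of weight `w` for the stress tensor `S`:
`S(z) O(0) ∼ w O / z² + ∂O / z`. -/
structure IsPrimary {n : ℕ} (S : VertexOperator ℂ (Fock n)) (w : ℂ)
    (O : VertexOperator ℂ (Fock n)) : Prop where
  first_order : nprod 0 0 0 S O = deriv O
  second_order : nprod 0 0 1 S O = w • O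
  higher_order : ∀ j : ℕ, 2 ≤ j → nprod 0 0 j S O = 0

/-- The even operator `O` is `Q`-closed and its BRST class is primary of weight `w` for the class
of the stress tensor `T`: the OPE `T'(z) O(0) ∼ w O / z² + ∂O / z` holds modulo `Q`-exact operators
for every operator `T' ≡ T`. -/
structure IsBRSTPrimary (n : ℕ) (w : ℂ) (O : VertexOperator ℂ (Fock n)) : Prop where
  mem : IsOperator 0 O
  closed : brst 0 O = 0
  first_order : ∀ T', IsOperator 0 T' → BRSTEquiv 0 T' (stressTensor n) →
    BRSTEquiv 0 (nprod 0 0 0 T' O) (deriv O)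
  second_order : ∀ T', IsOperator 0 T' → BRSTEquiv 0 T' (stressTensor n) →
    BRSTEquiv 0 (nprod 0 0 1 T' O) (w • O)
  higher_order : ∀ T', IsOperator 0 T' → BRSTEquiv 0 T' (stressTensor n) →
    ∀ j : ℕ, 2 ≤ j → BRSTEquiv 0 (nprod 0 0 j T' O) 0

end BosonicVOA

namespace BosonicVOA

/-! ## Calculus of modes and residue products -/

section Calculus

variable {V : Type*} [AddCommGroup V] [Module ℂ V]

/-! Write `A_i = -X_i Y_i`. Everything rests on how `T` and the `A_l` act on one application of
`D_i`, and these actions follow from the noncommutative Wick formula (`HasOPE.normal_right`).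

Call `O` of charge `s` if `A_l(z) O(0) ∼ s O / z` for every `l`, with the same `s` for all `l`; `𝒳`
has charge `1` and `𝒴` has charge `-1`. Suppose `X_i O` and `Y_i O` have simple poles `E` and `-F`
with the Euler relation `Y_i E + X_i F = O`. Then `A_i` has the double pole `-O` with `(A_i O)`,
since `A_i A_i` has level `-1`, and the double pole `2 O` with `(X_i (Y_i O))`. In `D_i O = 2 (A_i
O) + (X_i (Y_i O))` these cancel, so `D_i` preserves the charge (`gauge_pairD`). If also `O` is
primary of weight `w`, then `T` acts on `D_i O` with weight `w + 1` and third-order pole `2 s O`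
(`stress_pairD`). This pole does not depend on `i`, so `D_i - D_j` maps primaries to primaries.

The Euler relation for the index `l` survives `D_i` only when `l ≠ i`. This is why the indices are
distinct, and why `IsCharged` carries the set `S` of indices still available. Induction on the
number of pairs (`IsCharged.diffProd`) gives the primary property for `T`.

For the BRST statements, the current is `∑ c^a (A_{a+1} - A_a + h_a)`. Equal charges make it commute
with `P`, so `QP = 0`. As `Q` is a derivation, `(QC)₍ⱼ₎P = Q(C₍ⱼ₎P)`: replacing `T` by `T + QC`
changes each OPE coefficient by an exact term. -/

theorem field_ext {A B : VertexOperator ℂ V} (h : ∀ m, mode A m = mode B m) : A = B := by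
  apply HVertexOperator.coeff_inj
  funext m
  simpa using h (-m - 1)

theorem mode_add (A B : VertexOperator ℂ V) (m : ℤ) :
    mode (A + B) m = mode A m + mode B m := by simp [mode]

theorem mode_sub (A B : VertexOperator ℂ V) (m : ℤ) :
    mode (A - B) m = mode A m - mode B m := by simp [mode]

theorem mode_neg (A : VertexOperator ℂ V) (m : ℤ) : mode (-A) m = -mode A m := by simp [mode]

theorem mode_smul (t : ℂ) (A : VertexOperator ℂ V) (m : ℤ) :
    mode (t • A) m = t • mode A m := by simp [mode]

theorem mode_zero (m : ℤ) : mode (0 : VertexOperator ℂ V) m = 0 := by simp [mode]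

theorem neg_eq_smul (A : VertexOperator ℂ V) : -A = (-1 : ℂ) • A :=
  field_ext fun m => by rw [mode_neg, mode_smul, neg_one_smul]

theorem mode_deriv (A : VertexOperator ℂ V) (m : ℤ) :
    mode (deriv A) m = (-m) • mode A (m - 1) := mode_ofModes _ _ _

theorem mode_oneField (m : ℤ) :
    mode (oneField V) m = if m = -1 then 1 else 0 := mode_ofModes _ _ _

/-- Multiplication of a field by `z ^ p`. -/
noncomputable def shift (p : ℤ) (A : VertexOperator ℂ V) : VertexOperator ℂ V :=
  ofModes (fun m => mode A (m + p)) (by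
    intro v
    obtain ⟨N, hN⟩ := exists_mode_eq_zero A v
    exact ⟨N - p, fun m hm => hN _ (by omega)⟩)

theorem mode_shift (p : ℤ) (A : VertexOperator ℂ V) (m : ℤ) :
    mode (shift p A) m = mode A (m + p) := mode_ofModes _ _ _

/-- The field of commutators of an endomorphism with the modes of a field. -/
noncomputable def ad (d : Module.End ℂ V) (A : VertexOperator ℂ V) : VertexOperator ℂ V :=
  ofModes (fun m => d * mode A m - mode A m * d) (by
    intro v
    obtain ⟨N, hN⟩ := exists_mode_eq_zero A v
    obtain ⟨M, hM⟩ := exists_mode_eq_zero A (d v)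
    exact ⟨max N M, fun m hm => by simp [hN m (by omega), hM m (by omega)]⟩)

theorem mode_ad (d : Module.End ℂ V) (A : VertexOperator ℂ V) (m : ℤ) :
    mode (ad d A) m = d * mode A m - mode A m * d := mode_ofModes _ _ _

theorem shift_zero (A : VertexOperator ℂ V) : shift 0 A = A :=
  field_ext fun m => by rw [mode_shift, add_zero]

theorem shift_shift (p r : ℤ) (A : VertexOperator ℂ V) :
    shift p (shift r A) = shift (p + r) A :=
  field_ext fun m => by simp only [mode_shift, add_assoc]

theorem shift_add_field (p : ℤ) (A B : VertexOperator ℂ V) :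
    shift p (A + B) = shift p A + shift p B :=
  field_ext fun m => by simp only [mode_shift, mode_add]

theorem shift_smul (p : ℤ) (t : ℂ) (A : VertexOperator ℂ V) :
    shift p (t • A) = t • shift p A :=
  field_ext fun m => by simp only [mode_shift, mode_smul]

theorem shift_zero_field (p : ℤ) : shift p (0 : VertexOperator ℂ V) = 0 :=
  field_ext fun m => by simp only [mode_shift, mode_zero]

theorem shift_injective (p : ℤ) {A B : VertexOperator ℂ V} (h : shift p A = shift p B) :
    A = B := by
  rw [← shift_zero A, ← shift_zero B, ← neg_add_cancel p, ← shift_shift, ← shift_shift, h]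

theorem deriv_add (A B : VertexOperator ℂ V) : deriv (A + B) = deriv A + deriv B :=
  field_ext fun m => by simp only [mode_deriv, mode_add, smul_add]

theorem deriv_sub (A B : VertexOperator ℂ V) : deriv (A - B) = deriv A - deriv B :=
  field_ext fun m => by simp only [mode_deriv, mode_sub, smul_sub]

theorem deriv_neg (A : VertexOperator ℂ V) : deriv (-A) = -deriv A :=
  field_ext fun m => by simp only [mode_deriv, mode_neg, smul_neg]

theorem deriv_smul (t : ℂ) (A : VertexOperator ℂ V) : deriv (t • A) = t • deriv A :=
  field_ext fun m => by simp only [mode_deriv, mode_smul, smul_comm t]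

theorem deriv_zero : deriv (0 : VertexOperator ℂ V) = 0 :=
  field_ext fun m => by simp only [mode_deriv, mode_zero, smul_zero]

theorem deriv_oneField : deriv (oneField V) = 0 :=
  field_ext fun m => by
    rw [mode_deriv, mode_oneField, mode_zero]
    rcases eq_or_ne m 0 with rfl | h
    · simp
    · rw [if_neg (by omega), smul_zero]

/-! ### Modes of residue products -/

theorem mode_nprod_apply (p q : ZMod 2) (n m : ℤ) (A B : VertexOperator ℂ V) (v : V) :
    mode (nprod p q n A B) m v = ∑ᶠ j : ℕ, prodTerm (koszul p q) A B n m j v := by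
  rw [nprod, mode_ofModes]
  rfl

theorem hasFiniteSupport_prodTerm (ε : ℤ) (A B : VertexOperator ℂ V) (n m : ℤ) (v : V) :
    Function.HasFiniteSupport fun j => prodTerm ε A B n m j v :=
  finite_support_prodTerm ε A B n m v

theorem mode_nprod_eq_sum (p q : ZMod 2) (n m : ℤ) (A B : VertexOperator ℂ V) (v : V) (N : ℕ)
    (hA : ∀ j : ℕ, N ≤ j → mode A j v = 0) (hB : ∀ j : ℕ, N ≤ j → mode B (m + j) v = 0) :
    mode (nprod p q n A B) m v =
      ∑ j ∈ Finset.range N, prodTerm (koszul p q) A B n m j v := by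
  rw [mode_nprod_apply]
  apply finsum_eq_sum_of_support_subset
  intro j hj
  by_contra h
  simp only [Finset.coe_range, Set.mem_Iio, not_lt] at h
  exact hj (by simp [prodTerm, hA j h, hB j h])

theorem exists_bound (A B : VertexOperator ℂ V) (m : ℤ) (v : V) :
    ∃ N : ℕ, (∀ j : ℕ, N ≤ j → mode A j v = 0) ∧ ∀ j : ℕ, N ≤ j → mode B (m + j) v = 0 := by
  obtain ⟨N₁, h₁⟩ := exists_mode_eq_zero A v
  obtain ⟨N₂, h₂⟩ := exists_mode_eq_zero B v
  exact ⟨N₁ + N₂ + m.natAbs, fun j hj => h₁ _ (by omega), fun j hj => h₂ _ (by omega)⟩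

theorem nprod_congr_term {p q : ZMod 2} {n : ℤ} {A B C : VertexOperator ℂ V}
    (h : ∀ m v, mode C m v = ∑ᶠ j : ℕ, prodTerm (koszul p q) A B n m j v) :
    nprod p q n A B = C :=
  field_ext fun m => LinearMap.ext fun v => by rw [mode_nprod_apply, h]

theorem nprod_shift_right (p q : ZMod 2) (n r : ℤ) (A B : VertexOperator ℂ V) :
    nprod p q n A (shift r B) = shift r (nprod p q n A B) :=
  nprod_congr_term fun m v => by
    rw [mode_shift, mode_nprod_apply]
    refine finsum_congr fun j => ?_
    simp only [prodTerm, mode_shift]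
    rw [show m + r + j = m + j + r by ring, show m + r + n - j = m + n - j + r by ring]

/-! ### Bilinearity of the residue products -/

theorem finsum_prodTerm_add (p q : ZMod 2) (n m : ℤ) (A B A' B' : VertexOperator ℂ V) (v : V) :
    mode (nprod p q n A B) m v + mode (nprod p q n A' B') m v =
      ∑ᶠ j : ℕ, (prodTerm (koszul p q) A B n m j v + prodTerm (koszul p q) A' B' n m j v) := by
  rw [mode_nprod_apply, mode_nprod_apply]
  exact (finsum_add_distrib (hasFiniteSupport_prodTerm _ _ _ _ _ _)
    (hasFiniteSupport_prodTerm _ _ _ _ _ _)).symm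

theorem nprod_add_left (p q : ZMod 2) (n : ℤ) (A B C : VertexOperator ℂ V) :
    nprod p q n (A + B) C = nprod p q n A C + nprod p q n B C :=
  nprod_congr_term fun m v => by
    rw [mode_add, LinearMap.add_apply, finsum_prodTerm_add]
    refine finsum_congr fun j => ?_
    simp only [prodTerm, mode_add, add_mul, mul_add, ← LinearMap.add_apply, ← smul_add]
    congr 2
    rw [smul_add]
    abel

theorem nprod_add_right (p q : ZMod 2) (n : ℤ) (A B C : VertexOperator ℂ V) :
    nprod p q n A (B + C) = nprod p q n A B + nprod p q n A C :=
  nprod_congr_term fun m v => by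
    rw [mode_add, LinearMap.add_apply, finsum_prodTerm_add]
    refine finsum_congr fun j => ?_
    simp only [prodTerm, mode_add, add_mul, mul_add, ← LinearMap.add_apply, ← smul_add]
    congr 2
    rw [smul_add]
    abel

theorem smul_mode_nprod (p q : ZMod 2) (n m : ℤ) (t : ℂ) (A B : VertexOperator ℂ V) (v : V) :
    t • mode (nprod p q n A B) m v =
      ∑ᶠ j : ℕ, t • prodTerm (koszul p q) A B n m j v := by
  rw [mode_nprod_apply]
  exact smul_finsum' t (hasFiniteSupport_prodTerm _ _ _ _ _ _)

theorem nprod_smul_left (p q : ZMod 2) (n : ℤ) (t : ℂ) (A B : VertexOperator ℂ V) :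
    nprod p q n (t • A) B = t • nprod p q n A B :=
  nprod_congr_term fun m v => by
    rw [mode_smul, LinearMap.smul_apply, smul_mode_nprod]
    refine finsum_congr fun j => ?_
    simp only [prodTerm, mode_smul, ← LinearMap.smul_apply]
    rw [smul_comm t, smul_sub, smul_comm t (koszul p q * (n.negOnePow : ℤ))]
    simp only [smul_mul_assoc, mul_smul_comm]

theorem nprod_smul_right (p q : ZMod 2) (n : ℤ) (t : ℂ) (A B : VertexOperator ℂ V) :
    nprod p q n A (t • B) = t • nprod p q n A B :=
  nprod_congr_term fun m v => by
    rw [mode_smul, LinearMap.smul_apply, smul_mode_nprod]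
    refine finsum_congr fun j => ?_
    simp only [prodTerm, mode_smul, ← LinearMap.smul_apply]
    rw [smul_comm t, smul_sub, smul_comm t (koszul p q * (n.negOnePow : ℤ))]
    simp only [smul_mul_assoc, mul_smul_comm]

theorem nprod_neg_left (p q : ZMod 2) (n : ℤ) (A B : VertexOperator ℂ V) :
    nprod p q n (-A) B = -nprod p q n A B := by
  rw [neg_eq_smul, nprod_smul_left, ← neg_eq_smul]

theorem nprod_neg_right (p q : ZMod 2) (n : ℤ) (A B : VertexOperator ℂ V) :
    nprod p q n A (-B) = -nprod p q n A B := by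
  rw [neg_eq_smul, nprod_smul_right, ← neg_eq_smul]

theorem nprod_sub_left (p q : ZMod 2) (n : ℤ) (A B C : VertexOperator ℂ V) :
    nprod p q n (A - B) C = nprod p q n A C - nprod p q n B C := by
  rw [sub_eq_add_neg, nprod_add_left, nprod_neg_left, sub_eq_add_neg]

theorem nprod_sub_right (p q : ZMod 2) (n : ℤ) (A B C : VertexOperator ℂ V) :
    nprod p q n A (B - C) = nprod p q n A B - nprod p q n A C := by
  rw [sub_eq_add_neg, nprod_add_right, nprod_neg_right, sub_eq_add_neg]

theorem nprod_zero_left (p q : ZMod 2) (n : ℤ) (B : VertexOperator ℂ V) :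
    nprod p q n 0 B = 0 := by
  simpa using nprod_smul_left p q n 0 0 B

theorem nprod_zero_right (p q : ZMod 2) (n : ℤ) (A : VertexOperator ℂ V) :
    nprod p q n A 0 = 0 := by
  simpa using nprod_smul_right p q n 0 A 0

/-! ### Commutators with modes and multiplication by `z` -/

theorem mode_nprod_zero (p q : ZMod 2) (m : ℤ) (A B : VertexOperator ℂ V) :
    mode (nprod p q 0 A B) m = mode A 0 * mode B m - koszul p q • (mode B m * mode A 0) := by
  ext v
  rw [mode_nprod_apply, finsum_eq_single _ 0]
  · simp [prodTerm]
  · intro j hj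
    obtain ⟨j, rfl⟩ := Nat.exists_eq_succ_of_ne_zero hj
    simp [prodTerm, Ring.choose_zero_succ]

/-- `A₍ₚ₎` is the zero mode of `z^p A(z)`. Commutators with all modes are thereby reduced to zeroth
products. -/
theorem ad_eq_nprod (A B : VertexOperator ℂ V) (p : ℤ) :
    ad (mode A p) B = nprod 0 0 0 (shift p A) B :=
  field_ext fun m => by simp [mode_ad, mode_nprod_zero, mode_shift, koszul]

/-- Summation by parts for coefficients related by Pascal's rule. It is applied with `c j = (-1)^j
(n choose j)` and `d j = (-1)^j (n+1 choose j)`. -/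
theorem sum_pascal {M : Type*} [AddCommGroup M] (c d : ℕ → ℤ) (h₀ : d 0 = c 0)
    (h : ∀ j, d (j + 1) = c (j + 1) - c j) (x : ℕ → M) (N : ℕ) (hx : x N = 0) :
    ∑ j ∈ Finset.range N, c j • x j =
      ∑ j ∈ Finset.range (N + 1), d j • x j + ∑ j ∈ Finset.range N, c j • x (j + 1) := by
  have h₁ : ∑ j ∈ Finset.range N, c j • x j = ∑ j ∈ Finset.range (N + 1), c j • x j := by
    rw [Finset.sum_range_succ, hx, smul_zero, add_zero]
  rw [h₁, Finset.sum_range_succ', Finset.sum_range_succ', h₀, add_right_comm,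
    ← Finset.sum_add_distrib]
  congr 1
  refine Finset.sum_congr rfl fun j _ => ?_
  rw [h, sub_smul, sub_add_cancel]

/-- This is `z = (z - w) + w` inserted in the contour integral: the first term raises the order of
the product, the second comes out as a factor. -/
theorem nprod_shift_left (p q : ZMod 2) (n : ℤ) (A B : VertexOperator ℂ V) :
    nprod p q n (shift 1 A) B = nprod p q (n + 1) A B + shift 1 (nprod p q n A B) := by
  refine field_ext fun m => LinearMap.ext fun v => ?_
  obtain ⟨N, hA, hB⟩ := exists_bound A B m v
  rw [mode_add, mode_shift, LinearMap.add_apply,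
    mode_nprod_eq_sum p q n m (shift 1 A) B v N (fun j hj => by
      rw [mode_shift]; exact_mod_cast hA (j + 1) (by omega)) hB,
    mode_nprod_eq_sum p q (n + 1) m A B v (N + 1) (fun j hj => hA j (by omega))
      (fun j hj => hB j (by omega)),
    mode_nprod_eq_sum p q n (m + 1) A B v N hA (fun j hj => by
      have := hB (j + 1) (by omega)
      rwa [show m + ((j + 1 : ℕ) : ℤ) = m + 1 + j by push_cast; ring] at this)]
  set c : ℕ → ℤ := fun j => (-1) ^ j * Ring.choose n j with hc
  set d : ℕ → ℤ := fun j => (-1) ^ j * Ring.choose (n + 1) j with hd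
  set s : ℤ := koszul p q * (n.negOnePow : ℤ) with hs
  set a : ℕ → V := fun j => mode A (n + 1 - j) (mode B (m + j) v) with ha
  set b : ℕ → V := fun j => mode B (m + n + 1 - j) (mode A j v) with hb
  have hd0 : d 0 = c 0 := by simp [hc, hd]
  have hds : ∀ j, d (j + 1) = c (j + 1) - c j := fun j => by
    simp only [hc, hd, Ring.choose_succ_succ]
    ring
  have e₁ : ∀ j, prodTerm (koszul p q) (shift 1 A) B n m j v
      = c j • a j - s • c j • b (j + 1) := fun j => by
    simp only [prodTerm, LinearMap.smul_apply, LinearMap.sub_apply, Module.End.mul_apply,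
      mode_shift, hc, ha, hb, hs, smul_sub]
    rw [show n - (j : ℤ) + 1 = n + 1 - j by ring,
      show m + n + 1 - ((j + 1 : ℕ) : ℤ) = m + n - j by push_cast; ring]
    push_cast
    rw [smul_comm (koszul p q * (n.negOnePow : ℤ))]
  have e₂ : ∀ j, prodTerm (koszul p q) A B (n + 1) m j v
      = d j • a j + s • d j • b j := fun j => by
    simp only [prodTerm, LinearMap.smul_apply, LinearMap.sub_apply, Module.End.mul_apply,
      hd, ha, hb, hs, smul_sub, Int.negOnePow_succ]
    rw [show m + (n + 1) - (j : ℤ) = m + n + 1 - j by ring]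
    rw [smul_comm (koszul p q * (n.negOnePow : ℤ))]
    simp [sub_eq_add_neg]
  have e₃ : ∀ j, prodTerm (koszul p q) A B n (m + 1) j v
      = c j • a (j + 1) - s • c j • b j := fun j => by
    simp only [prodTerm, LinearMap.smul_apply, LinearMap.sub_apply, Module.End.mul_apply,
      hc, ha, hb, hs, smul_sub]
    rw [show n + 1 - ((j + 1 : ℕ) : ℤ) = n - j by push_cast; ring,
      show m + ((j + 1 : ℕ) : ℤ) = m + 1 + j by push_cast; ring,
      show m + n + 1 - (j : ℤ) = m + 1 + n - j by ring,
      smul_comm (koszul p q * (n.negOnePow : ℤ))]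
  simp only [e₁, e₂, e₃, Finset.sum_add_distrib, Finset.sum_sub_distrib, ← Finset.smul_sum]
  have haN : a N = 0 := by simp [ha, hB N le_rfl]
  have hbN : b N = 0 := by simp [hb, hA N le_rfl]
  rw [sum_pascal c d hd0 hds a N haN, sum_pascal c d hd0 hds b N hbN, smul_add]
  abel

/-- Commutation with an endomorphism is a derivation of the residue products. -/
theorem ad_nprod (p q : ZMod 2) (n : ℤ) (d : Module.End ℂ V) (A B : VertexOperator ℂ V) :
    ad d (nprod p q n A B) = nprod p q n (ad d A) B + nprod p q n A (ad d B) := by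
  refine field_ext fun m => LinearMap.ext fun v => ?_
  rw [mode_ad, mode_add, LinearMap.add_apply, finsum_prodTerm_add, LinearMap.sub_apply,
    Module.End.mul_apply, Module.End.mul_apply, mode_nprod_apply, mode_nprod_apply,
    map_finsum d (hasFiniteSupport_prodTerm _ _ _ _ _ _), ← finsum_sub_distrib]
  · refine finsum_congr fun j => ?_
    simp only [prodTerm, LinearMap.smul_apply, LinearMap.sub_apply, Module.End.mul_apply,
      mode_ad, map_sub, map_zsmul, ← smul_sub, ← smul_add]
    congr 1
    simp only [smul_sub]
    abel
  · exact (finite_support_prodTerm (koszul p q) A B n m v).subset fun j hj h =>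
      hj (by simp only [h, map_zero])
  · exact hasFiniteSupport_prodTerm _ _ _ _ _ _

/-! ### Normally ordered products: Leibniz rule and left commutativity -/

theorem prodTerm_neg_one (ε : ℤ) (A B : VertexOperator ℂ V) (m : ℤ) (j : ℕ) (v : V) :
    prodTerm ε A B (-1) m j v =
      mode A (-1 - j) (mode B (m + j) v) + ε • mode B (m - 1 - j) (mode A j v) := by
  have h : ((-1) ^ j * Ring.choose (-1) j : ℤ) = 1 := by
    rw [Ring.choose_neg]
    simp [Ring.choose_natCast, ← mul_pow, Int.negOnePow_def, Units.smul_def]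
  rw [prodTerm, h, one_smul]
  simp [sub_eq_add_neg]

theorem deriv_normal (p q : ZMod 2) (A B : VertexOperator ℂ V) :
    deriv (normal p q A B) = normal p q (deriv A) B + normal p q A (deriv B) := by
  refine field_ext fun m => LinearMap.ext fun v => ?_
  obtain ⟨N, hA, hB⟩ := exists_bound A B (m - 1) v
  have hB' : ∀ j : ℕ, N ≤ j → mode B (m + j) v = 0 := fun j hj => by
    simpa [add_comm (1 : ℤ)] using hB (j + 1) (by omega)
  rw [mode_deriv, mode_add, LinearMap.add_apply, LinearMap.smul_apply,
    mode_nprod_eq_sum p q (-1) (m - 1) A B v (N + 1) (fun j hj => hA j (by omega))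
      (fun j hj => hB j (by omega)),
    mode_nprod_eq_sum p q (-1) m (deriv A) B v (N + 1) (fun j hj => by
      obtain ⟨j, rfl⟩ : ∃ i, j = i + 1 := ⟨j - 1, by omega⟩
      rw [mode_deriv, LinearMap.smul_apply, Nat.cast_succ, add_sub_cancel_right,
        hA j (by omega), smul_zero]) (fun j hj => hB' j (by omega)),
    mode_nprod_eq_sum p q (-1) m A (deriv B) v (N + 1) (fun j hj => hA j (by omega))
      (fun j hj => by
        rw [mode_deriv, LinearMap.smul_apply, add_sub_right_comm, hB j (by omega), smul_zero]),
    ← sub_eq_zero, Finset.smul_sum, ← Finset.sum_add_distrib, ← Finset.sum_sub_distrib]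
  -- The difference of the two sides telescopes in `f` and `g`. The factor `j` kills the lower
  -- boundary term, and the truncation at `N + 1` kills the upper one.
  set f : ℕ → V := fun j => (j : ℤ) • mode A (-1 - j) (mode B (m - 1 + j) v) with hf
  set g : ℕ → V := fun j => (j : ℤ) • mode B (m - 1 - j) (mode A (j - 1) v) with hg
  have e : ∀ j ∈ Finset.range (N + 1),
      (-m) • prodTerm (koszul p q) A B (-1) (m - 1) j v -
        (prodTerm (koszul p q) (deriv A) B (-1) m j v +
          prodTerm (koszul p q) A (deriv B) (-1) m j v)
      = -((f (j + 1) - f j) + koszul p q • (g (j + 1) - g j)) := fun j _ => by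
    simp only [prodTerm_neg_one, mode_deriv, hf, hg, LinearMap.smul_apply, map_zsmul,
      smul_add, smul_sub, smul_comm _ (koszul p q)]
    push_cast
    rw [show -1 - (j : ℤ) - 1 = -1 - (j + 1) by ring, show m - 1 + ((j : ℤ) + 1) = m + j by ring,
      show m + (j : ℤ) - 1 = m - 1 + j by ring, show m - 1 - ((j : ℤ) + 1) = m - 1 - 1 - j by ring,
      show (j : ℤ) + 1 - 1 = j by ring, show m - 1 - (j : ℤ) - 1 = m - 1 - 1 - j by ring]
    module
  rw [Finset.sum_congr rfl e, Finset.sum_neg_distrib, Finset.sum_add_distrib, ← Finset.smul_sum,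
    Finset.sum_range_sub, Finset.sum_range_sub]
  have h₁ := hA N le_rfl
  have h₂ := hB (N + 1) (by omega)
  rw [show m - 1 + ((N + 1 : ℕ) : ℤ) = m + N by push_cast; ring] at h₂
  simp [hf, hg, h₁, h₂]

/-- The summands of the modes of `A₍ₘ₎(B₍ₙ₎C)` for even fields. -/
noncomputable def nestedTerm (A B C : VertexOperator ℂ V) (m n k : ℤ) (v : V) (j i : ℕ) : V :=
  ((-1) ^ j * Ring.choose m j * ((-1) ^ i * Ring.choose n i) : ℤ) •
    (mode A (m - j) (mode B (n - i) (mode C (k + j + i) v)) -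
      (n.negOnePow : ℤ) • mode A (m - j) (mode C (k + j + n - i) (mode B i v)) -
      (m.negOnePow : ℤ) • mode B (n - i) (mode C (k + m - j + i) (mode A j v)) +
      (m.negOnePow * n.negOnePow : ℤ) • mode C (k + m - j + n - i) (mode B i (mode A j v)))

theorem exists_mode_nested_eq_sum (A B C : VertexOperator ℂ V) (m n k : ℤ) (v : V) :
    ∃ N : ℕ, ∀ M, N ≤ M → mode (nprod 0 0 m A (nprod 0 0 n B C)) k v =
      ∑ j ∈ Finset.range M, ∑ i ∈ Finset.range M, nestedTerm A B C m n k v j i := by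
  obtain ⟨N₁, hA, hE⟩ := exists_bound A (nprod 0 0 n B C) k v
  obtain ⟨N₂, hB, hC⟩ := exists_bound B C k v
  choose K hK₁ hK₂ using fun j : ℕ => exists_bound B C (k + m - j) (mode A j v)
  refine ⟨N₁ + N₂ + ∑ j ∈ Finset.range N₁, K j, fun M hM => ?_⟩
  rw [mode_nprod_eq_sum 0 0 m k A _ v M (fun j hj => hA j (by omega))
    (fun j hj => hE j (by omega))]
  -- The inner truncation bound `K j` depends on `j`, but it is needed only for the finitely many `j
  -- < N₁`; beyond these `A₍ⱼ₎v = 0`.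
  refine Finset.sum_congr rfl fun j _ => ?_
  have h₁ := mode_nprod_eq_sum 0 0 n (k + j) B C v M (fun i hi => hB i (by omega))
    (fun i hi => by simpa [add_assoc] using hC (j + i) (by omega))
  have h₂ : mode (nprod 0 0 n B C) (k + m - j) (mode A j v) =
      ∑ i ∈ Finset.range M, prodTerm (koszul 0 0) B C n (k + m - j) i (mode A j v) := by
    by_cases hj : j < N₁
    · have : K j ≤ ∑ j ∈ Finset.range N₁, K j :=
        Finset.single_le_sum (f := K) (fun _ _ => Nat.zero_le _) (Finset.mem_range.2 hj)
      exact mode_nprod_eq_sum 0 0 n (k + m - j) B C _ M (fun i hi => hK₁ j i (by omega))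
        (fun i hi => hK₂ j i (by omega))
    · simp [hA j (by omega)]
  rw [prodTerm, LinearMap.smul_apply, LinearMap.sub_apply, LinearMap.smul_apply,
    Module.End.mul_apply, Module.End.mul_apply, h₁, h₂, map_sum, Finset.smul_sum,
    ← Finset.sum_sub_distrib, Finset.smul_sum]
  refine Finset.sum_congr rfl fun i _ => ?_
  simp only [prodTerm, nestedTerm, koszul, ZMod.val_zero, mul_zero, pow_zero, one_mul,
    LinearMap.smul_apply, LinearMap.sub_apply, Module.End.mul_apply, map_sub, map_zsmul]
  module

/-- When the modes of `A` and `B` commute, the expanded double sum is symmetric under exchanging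
`(A, m, j)` with `(B, n, i)`. -/
theorem nprod_left_comm {A B : VertexOperator ℂ V}
    (h : ∀ p q, mode A p * mode B q = mode B q * mode A p) (m n : ℤ) (C : VertexOperator ℂ V) :
    nprod 0 0 m A (nprod 0 0 n B C) = nprod 0 0 n B (nprod 0 0 m A C) := by
  have h' : ∀ p q v, mode A p (mode B q v) = mode B q (mode A p v) := fun p q v =>
    LinearMap.congr_fun (h p q) v
  refine field_ext fun k => LinearMap.ext fun v => ?_
  obtain ⟨N₁, h₁⟩ := exists_mode_nested_eq_sum A B C m n k v
  obtain ⟨N₂, h₂⟩ := exists_mode_nested_eq_sum B A C n m k v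
  rw [h₁ (max N₁ N₂) (le_max_left _ _), h₂ (max N₁ N₂) (le_max_right _ _), Finset.sum_comm]
  refine Finset.sum_congr rfl fun i _ => Finset.sum_congr rfl fun j _ => ?_
  simp only [nestedTerm, h']
  rw [show k + (i : ℤ) + j = k + j + i by ring, show k + (i : ℤ) + m - j = k + m - j + i by ring,
    show k + n - (i : ℤ) + j = k + j + n - i by ring,
    show k + n - (i : ℤ) + m - j = k + m - j + n - i by ring]
  module

end Calculus

/-! ## Operator product expansions with poles of order at most three -/

section OPE

variable {V : Type*} [AddCommGroup V] [Module ℂ V]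

/-- `A(z)C(w) ∼ E₀/(z-w) + E₁/(z-w)² + E₂/(z-w)³` for the even field `A`, as an identity of
commutators of modes. -/
def HasOPE (A C E₀ E₁ E₂ : VertexOperator ℂ V) : Prop :=
  ∀ p k : ℤ, mode A p * mode C k - mode C k * mode A p =
    mode E₀ (k + p) + (p : ℂ) • mode E₁ (k + p - 1) +
      ((p : ℂ) * (p - 1) / 2) • mode E₂ (k + p - 2)

/-- All modes of `A` commute with all modes of `C`. -/
abbrev Commutes (A C : VertexOperator ℂ V) : Prop := HasOPE A C 0 0 0

variable {A B C E₀ E₁ E₂ F₀ F₁ F₂ : VertexOperator ℂ V}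

theorem commutes_iff :
    Commutes A C ↔ ∀ p k, mode A p * mode C k = mode C k * mode A p := by
  simp only [Commutes, HasOPE, mode_zero, smul_zero, add_zero, sub_eq_zero]

theorem HasOPE.congr (h : HasOPE A C E₀ E₁ E₂) (h₀ : E₀ = F₀) (h₁ : E₁ = F₁) (h₂ : E₂ = F₂) :
    HasOPE A C F₀ F₁ F₂ := h₀ ▸ h₁ ▸ h₂ ▸ h

theorem HasOPE.add_right (h : HasOPE A B E₀ E₁ E₂) (h' : HasOPE A C F₀ F₁ F₂) :
    HasOPE A (B + C) (E₀ + F₀) (E₁ + F₁) (E₂ + F₂) := fun p k => by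
  simp only [mode_add, mul_add, add_mul, add_sub_add_comm, h p k, h' p k]
  module

theorem HasOPE.add_left (h : HasOPE A C E₀ E₁ E₂) (h' : HasOPE B C F₀ F₁ F₂) :
    HasOPE (A + B) C (E₀ + F₀) (E₁ + F₁) (E₂ + F₂) := fun p k => by
  simp only [mode_add, mul_add, add_mul, add_sub_add_comm, h p k, h' p k]
  module

theorem HasOPE.smul_right (t : ℂ) (h : HasOPE A C E₀ E₁ E₂) :
    HasOPE A (t • C) (t • E₀) (t • E₁) (t • E₂) := fun p k => by
  simp only [mode_smul, mul_smul_comm, smul_mul_assoc, ← smul_sub, h p k]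
  module

theorem HasOPE.smul_left (t : ℂ) (h : HasOPE A C E₀ E₁ E₂) :
    HasOPE (t • A) C (t • E₀) (t • E₁) (t • E₂) := fun p k => by
  simp only [mode_smul, mul_smul_comm, smul_mul_assoc, ← smul_sub, h p k]
  module

theorem HasOPE.neg_right (h : HasOPE A C E₀ E₁ E₂) : HasOPE A (-C) (-E₀) (-E₁) (-E₂) := by
  simpa only [← neg_eq_smul] using h.smul_right (-1)

theorem HasOPE.neg_left (h : HasOPE A C E₀ E₁ E₂) : HasOPE (-A) C (-E₀) (-E₁) (-E₂) := by
  simpa only [← neg_eq_smul] using h.smul_left (-1)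

theorem HasOPE.sub_right (h : HasOPE A B E₀ E₁ E₂) (h' : HasOPE A C F₀ F₁ F₂) :
    HasOPE A (B - C) (E₀ - F₀) (E₁ - F₁) (E₂ - F₂) := by
  simpa only [← sub_eq_add_neg] using h.add_right h'.neg_right

theorem HasOPE.sub_left (h : HasOPE A C E₀ E₁ E₂) (h' : HasOPE B C F₀ F₁ F₂) :
    HasOPE (A - B) C (E₀ - F₀) (E₁ - F₁) (E₂ - F₂) := by
  simpa only [← sub_eq_add_neg] using h.add_left h'.neg_left

theorem HasOPE.zero_right (A : VertexOperator ℂ V) : Commutes A 0 :=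
  commutes_iff.2 fun p k => by simp only [mode_zero, mul_zero, zero_mul]

theorem HasOPE.zero_left (C : VertexOperator ℂ V) : Commutes 0 C :=
  commutes_iff.2 fun p k => by simp only [mode_zero, mul_zero, zero_mul]

theorem HasOPE.sum_right {ι : Type*} (s : Finset ι) {C E₀ E₁ E₂ : ι → VertexOperator ℂ V}
    (h : ∀ i ∈ s, HasOPE A (C i) (E₀ i) (E₁ i) (E₂ i)) :
    HasOPE A (∑ i ∈ s, C i) (∑ i ∈ s, E₀ i) (∑ i ∈ s, E₁ i) (∑ i ∈ s, E₂ i) := by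
  classical
  induction s using Finset.induction_on with
  | empty => simpa using HasOPE.zero_right A
  | insert i s hi ih =>
    simp only [Finset.sum_insert hi]
    exact (h i (Finset.mem_insert_self i s)).add_right
      (ih fun j hj => h j (Finset.mem_insert_of_mem hj))

theorem Commutes.sum_right {ι : Type*} (s : Finset ι) {C : ι → VertexOperator ℂ V}
    (h : ∀ i ∈ s, Commutes A (C i)) : Commutes A (∑ i ∈ s, C i) := by
  simpa using HasOPE.sum_right s h

theorem Commutes.smul_right (t : ℂ) (h : Commutes A C) : Commutes A (t • C) := by
  simpa using HasOPE.smul_right t h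

theorem Commutes.neg_right (h : Commutes A C) : Commutes A (-C) := by
  simpa using HasOPE.neg_right h

theorem Commutes.sub_right (h : Commutes A B) (h' : Commutes A C) : Commutes A (B - C) := by
  simpa using HasOPE.sub_right h h'

theorem HasOPE.one_left (C : VertexOperator ℂ V) : Commutes (oneField V) C :=
  commutes_iff.2 fun p k => by rw [mode_oneField]; split_ifs <;> simp

theorem HasOPE.one_right (A : VertexOperator ℂ V) : Commutes A (oneField V) :=
  commutes_iff.2 fun p k => by rw [mode_oneField]; split_ifs <;> simp

/-- Skew-symmetry `B₍₀₎A = ∂(A₍₁₎B) - A₍₀₎B`, `B₍₁₎A = A₍₁₎B`. A third-order pole would contribute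
further derivatives. It allows each OPE to be computed with the simpler field on the left. -/
theorem HasOPE.skew (h : HasOPE A B E₀ E₁ 0) : HasOPE B A (deriv E₁ - E₀) E₁ 0 := fun p k => by
  rw [← neg_sub, h k p]
  simp only [mode_sub, mode_deriv, mode_zero, add_comm p k]
  module

theorem Commutes.symm (h : Commutes A B) : Commutes B A := by
  simpa [deriv_zero] using HasOPE.skew h

theorem HasOPE.deriv_right (h : HasOPE A C E₀ 0 0) : HasOPE A (deriv C) (deriv E₀) E₀ 0 :=
  fun p k => by
    have := h p (k - 1)
    simp only [mode_zero, smul_zero, add_zero] at this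
    simp only [mode_deriv, mul_smul_comm, smul_mul_assoc, ← smul_sub, this, mode_zero]
    rw [show k - 1 + p = k + p - 1 by ring]
    module

theorem Commutes.deriv_right (h : Commutes A C) : Commutes A (deriv C) := by
  simpa [deriv_zero] using HasOPE.deriv_right h

theorem HasOPE.deriv_left (h : HasOPE A C E₀ E₁ 0) :
    HasOPE (deriv A) C 0 (-E₀) ((-2 : ℂ) • E₁) := fun p k => by
  simp only [mode_deriv, mul_smul_comm, smul_mul_assoc, ← smul_sub, h (p - 1) k, mode_zero,
    mode_neg, mode_smul]
  rw [show k + (p - 1) - 1 = k + p - 2 by ring, show k + (p - 1) = k + p - 1 by ring]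
  push_cast
  module

theorem HasOPE.ad_eq (h : HasOPE A C E₀ E₁ E₂) (p : ℤ) :
    ad (mode A p) C = shift p E₀ + (p : ℂ) • shift (p - 1) E₁ +
      ((p : ℂ) * (p - 1) / 2) • shift (p - 2) E₂ :=
  field_ext fun k => by
    simp only [mode_ad, h p k, mode_add, mode_smul, mode_shift, ← add_sub_assoc]

theorem HasOPE.of_ad_eq (h : ∀ p : ℤ, ad (mode A p) C = shift p E₀ + (p : ℂ) • shift (p - 1) E₁ +
      ((p : ℂ) * (p - 1) / 2) • shift (p - 2) E₂) : HasOPE A C E₀ E₁ E₂ := fun p k => by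
  rw [← mode_ad, h p]
  simp only [mode_add, mode_smul, mode_shift, ← add_sub_assoc]

theorem HasOPE.shift_one (h : HasOPE A C E₀ E₁ E₂) :
    HasOPE (shift 1 A) C (shift 1 E₀ + E₁) (shift 1 E₁ + E₂) (shift 1 E₂) := fun p k => by
  simp only [mode_shift, h (p + 1) k, mode_add]
  rw [show k + (p + 1) - 2 = k + p - 2 + 1 by ring, show k + (p + 1) - 1 = k + p by ring,
    show k + (p + 1) = k + p + 1 by ring, show k + p - 1 + 1 = k + p by ring,
    show k + p - 2 + 1 = k + p - 1 by ring]
  push_cast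
  module

theorem HasOPE.nprod_zero (h : HasOPE A C E₀ E₁ E₂) : nprod 0 0 0 A C = E₀ := by
  have := h.ad_eq 0
  rw [ad_eq_nprod, shift_zero] at this
  rw [this]
  exact field_ext fun k => by simp [mode_shift]

/-- Used to read off higher products from lower ones: multiplying `A` by `z` keeps the OPE within
three poles. -/
theorem nprod_succ (p q : ZMod 2) (n : ℤ) (A B : VertexOperator ℂ V) :
    nprod p q (n + 1) A B = nprod p q n (shift 1 A) B - shift 1 (nprod p q n A B) := by
  rw [nprod_shift_left, add_sub_cancel_right]

theorem HasOPE.nprod_one (h : HasOPE A C E₀ E₁ E₂) : nprod 0 0 1 A C = E₁ := by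
  have := nprod_succ 0 0 0 A C
  rwa [h.nprod_zero, h.shift_one.nprod_zero, add_sub_cancel_left, zero_add] at this

theorem HasOPE.nprod_two (h : HasOPE A C E₀ E₁ E₂) : nprod 0 0 2 A C = E₂ := by
  have := nprod_succ 0 0 1 A C
  rwa [h.nprod_one, h.shift_one.nprod_one, add_sub_cancel_left] at this

theorem HasOPE.nprod_add_three (h : HasOPE A C E₀ E₁ E₂) (j : ℕ) :
    nprod 0 0 (j + 3) A C = 0 := by
  induction j generalizing A E₀ E₁ E₂ with
  | zero =>
    have := nprod_succ 0 0 2 A C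
    rw [h.nprod_two, h.shift_one.nprod_two, sub_self] at this
    simpa using this
  | succ j ih =>
    have := nprod_succ 0 0 (j + 3) A C
    rw [ih h, ih h.shift_one, shift_zero_field, sub_self] at this
    rw [← this]
    congr 1

/-! ### The noncommutative Wick formula -/

/-- Taylor expansion of `z^p` at `w` inside the normally ordered product: the terms `(z-w)` and
`(z-w)²` pick up the poles of `A` with `C`. The identity propagates from `p` to `p + 1` through `z =
(z - w) + w`, and back to negative `p` because multiplication by `z` is injective. -/
theorem HasOPE.normal_shift (h : HasOPE A C E₀ E₁ 0) (p : ℤ) :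
    normal 0 0 (shift p A) C = shift p (normal 0 0 A C) + (p : ℂ) • shift (p - 1) E₀ +
      ((p : ℂ) * (p - 1) / 2) • shift (p - 2) E₁ := by
  have step : ∀ p : ℤ, normal 0 0 (shift (p + 1) A) C =
      ad (mode A p) C + shift 1 (normal 0 0 (shift p A) C) := fun p => by
    rw [ad_eq_nprod, add_comm p, ← shift_shift]
    exact nprod_shift_left 0 0 (-1) (shift p A) C
  have e : ∀ p : ℤ, shift (p + 1) (normal 0 0 A C) + ((p + 1 : ℤ) : ℂ) • shift (p + 1 - 1) E₀ +
      (((p + 1 : ℤ) : ℂ) * ((p + 1 : ℤ) - 1) / 2) • shift (p + 1 - 2) E₁ = ad (mode A p) C +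
      shift 1 (shift p (normal 0 0 A C) + (p : ℂ) • shift (p - 1) E₀ +
      ((p : ℂ) * (p - 1) / 2) • shift (p - 2) E₁) := fun p => by
    rw [h.ad_eq]
    simp only [shift_add_field, shift_smul, shift_shift, shift_zero_field]
    rw [show 1 + p = p + 1 by ring, show 1 + (p - 1) = p by ring, show p + 1 - 1 = p by ring,
      show 1 + (p - 2) = p - 1 by ring, show p + 1 - 2 = p - 1 by ring]
    refine field_ext fun k => ?_
    simp only [mode_add, mode_smul, mode_zero]
    push_cast
    module
  induction p using Int.induction_on with
  | zero => exact field_ext fun k => by simp [shift_zero]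
  | succ p ih => rw [step, e, ih]
  | pred p ih =>
    have h₁ := step (-p - 1)
    have h₂ := e (-p - 1)
    rw [sub_add_cancel] at h₁ h₂
    rw [← ih, h₁] at h₂
    exact shift_injective 1 (add_left_cancel h₂)

/-- The OPE of an even field with a normally ordered product. -/
theorem HasOPE.normal_right {G₀ G₁ G₂ e₀ e₁ f₀ : VertexOperator ℂ V} (hB : HasOPE A B F₀ F₁ 0)
    (hC : HasOPE A C G₀ G₁ G₂) (h₀ : HasOPE F₀ C e₀ e₁ 0) (h₁ : HasOPE F₁ C f₀ 0 0) :
    HasOPE A (normal 0 0 B C) (normal 0 0 F₀ C + normal 0 0 B G₀)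
      (e₀ + normal 0 0 F₁ C + normal 0 0 B G₁) (e₁ + (2 : ℂ) • f₀ + normal 0 0 B G₂) := by
  refine HasOPE.of_ad_eq fun p => ?_
  -- The commutator with `A₍ₚ₎` turns `B` into `z^p F₀ + p z^(p-1) F₁`. Moving these powers out of
  -- the product with `C` yields the double contractions `e₀`, `e₁`, `f₀`; the `2` before `f₀` is `p
  -- (p-1)` measured in units of `p (p-1) / 2`.
  have n₀ := h₀.normal_shift p
  have n₁ := h₁.normal_shift (p - 1)
  rw [ad_nprod, hB.ad_eq, hC.ad_eq]
  simp only [normal] at n₀ n₁ ⊢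
  simp only [nprod_add_left, nprod_add_right, nprod_smul_left, nprod_smul_right,
    nprod_shift_right, shift_zero_field, nprod_zero_left]
  rw [n₀, n₁]
  refine field_ext fun k => ?_
  simp only [mode_add, mode_smul, mode_zero, mode_shift, mode_smul]
  rw [show k + (p - 1 - 1) = k + (p - 2) by ring]
  push_cast
  module

theorem Commutes.nprod_right (p q : ZMod 2) (n : ℤ) (hB : Commutes A B) (hC : Commutes A C) :
    Commutes A (nprod p q n B C) := by
  refine HasOPE.of_ad_eq fun r => ?_
  rw [ad_nprod, hB.ad_eq, hC.ad_eq]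
  simp [shift_zero_field, nprod_zero_left, nprod_zero_right]

theorem Commutes.left_comm (h : Commutes A B) (C : VertexOperator ℂ V) :
    normal 0 0 A (normal 0 0 B C) = normal 0 0 B (normal 0 0 A C) :=
  nprod_left_comm (commutes_iff.1 h) (-1) (-1) C

theorem normal_one (A : VertexOperator ℂ V) : normal 0 0 A (oneField V) = A := by
  refine nprod_congr_term fun m v => ?_
  simp only [prodTerm_neg_one, mode_oneField, koszul]
  rcases lt_or_ge m 0 with hm | hm
  · rw [finsum_eq_single _ (-1 - m).toNat]
    · rw [if_pos (by omega), if_neg (by omega)]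
      simp [show -1 - max (-1 - m) 0 = m by omega]
    · intro j hj
      rw [if_neg (by omega), if_neg (by omega)]
      simp
  · rw [finsum_eq_single _ m.toNat]
    · rw [if_neg (by omega), if_pos (by omega)]
      simp [hm]
    · intro j hj
      rw [if_neg (by omega), if_neg (by omega)]
      simp

theorem one_normal (A : VertexOperator ℂ V) : normal 0 0 (oneField V) A = A := by
  refine nprod_congr_term fun m v => ?_
  simp only [prodTerm_neg_one, mode_oneField, koszul]
  rw [finsum_eq_single _ 0]
  · simp
  · intro j hj
    rw [if_neg (by omega), if_neg (by omega)]
    simp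

end OPE

/-! ## OPEs of the free fields -/

section FreeFieldOPE

theorem mode_freeField_ofNat {V : Type*} [AddCommGroup V] [Module ℂ V]
    (cre ann : ℕ → Module.End ℂ V) (h : ∀ v, ∃ N : ℕ, ∀ r, N ≤ r → ann r v = 0) (r : ℕ) :
    mode (freeField cre ann h) (Int.ofNat r) = ann r := mode_ofModes _ _ _

theorem mode_freeField_negSucc {V : Type*} [AddCommGroup V] [Module ℂ V]
    (cre ann : ℕ → Module.End ℂ V) (h : ∀ v, ∃ N : ℕ, ∀ r, N ≤ r → ann r v = 0) (r : ℕ) :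
    mode (freeField cre ann h) (Int.negSucc r) = cre r := mode_ofModes _ _ _

/-- A simple pole `t / z` means `[A₍ₚ₎, C₍ₖ₎] = t` when `p + k = -1` and zero otherwise. With
creation modes indexed by `-1 - r`, this is exactly `r = s` in the mixed cases. -/
theorem HasOPE.freeField {V : Type*} [AddCommGroup V] [Module ℂ V] (t : ℂ)
    {cre ann cre' ann' : ℕ → Module.End ℂ V} {h : ∀ v, ∃ N : ℕ, ∀ r, N ≤ r → ann r v = 0}
    {h' : ∀ v, ∃ N : ℕ, ∀ r, N ≤ r → ann' r v = 0}
    (hcc : ∀ r s, cre r * cre' s = cre' s * cre r)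
    (haa : ∀ r s, ann r * ann' s = ann' s * ann r)
    (hac : ∀ r s, ann r * cre' s = cre' s * ann r + if r = s then t • 1 else 0)
    (hca : ∀ r s, cre r * ann' s = ann' s * cre r + if r = s then t • 1 else 0) :
    HasOPE (freeField cre ann h) (freeField cre' ann' h') (t • oneField V) 0 0 := fun p k => by
  simp only [mode_zero, smul_zero, add_zero, mode_smul, mode_oneField]
  rcases p with r | r <;> rcases k with s | s
  · rw [mode_freeField_ofNat, mode_freeField_ofNat, haa, sub_self,
      if_neg (by simp only [Int.ofNat_eq_natCast]; omega), smul_zero]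
  · rw [mode_freeField_ofNat, mode_freeField_negSucc, hac, add_sub_cancel_left]
    by_cases hrs : r = s
    · rw [if_pos hrs, if_pos (by simp only [Int.ofNat_eq_natCast]; omega)]
    · rw [if_neg hrs, if_neg (by simp only [Int.ofNat_eq_natCast]; omega), smul_zero]
  · rw [mode_freeField_ofNat, mode_freeField_negSucc, hca, add_sub_cancel_left]
    by_cases hrs : r = s
    · rw [if_pos hrs, if_pos (by simp only [Int.ofNat_eq_natCast]; omega)]
    · rw [if_neg hrs, if_neg (by simp only [Int.ofNat_eq_natCast]; omega), smul_zero]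
  · rw [mode_freeField_negSucc, mode_freeField_negSucc, hcc, sub_self, if_neg (by omega),
      smul_zero]

theorem commutes_freeField {V : Type*} [AddCommGroup V] [Module ℂ V]
    {cre ann cre' ann' : ℕ → Module.End ℂ V} {h : ∀ v, ∃ N : ℕ, ∀ r, N ≤ r → ann r v = 0}
    {h' : ∀ v, ∃ N : ℕ, ∀ r, N ≤ r → ann' r v = 0}
    (hcc : ∀ r s, cre r * cre' s = cre' s * cre r)
    (haa : ∀ r s, ann r * ann' s = ann' s * ann r)
    (hac : ∀ r s, ann r * cre' s = cre' s * ann r)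
    (hca : ∀ r s, cre r * ann' s = ann' s * cre r) :
    Commutes (freeField cre ann h) (freeField cre' ann' h') :=
  (HasOPE.freeField 0 hcc haa (fun r s => by simp [hac]) fun r s => by simp [hca]).congr
    (zero_smul _ _) rfl rfl

theorem neg_mul_comm_of_comm {V : Type*} [AddCommGroup V] [Module ℂ V] {a b : Module.End ℂ V}
    (h : a * b = b * a) : -a * b = b * -a := by
  rw [neg_mul, mul_neg, h]

theorem mul_neg_eq_add {V : Type*} [AddCommGroup V] [Module ℂ V] {a b c : Module.End ℂ V}
    (h : a * b = b * a + c) : b * -a = -a * b + c := by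
  rw [neg_mul, mul_neg, h]
  abel

theorem sum_smul_mul_comm {V ι : Type*} [AddCommGroup V] [Module ℂ V] (s : Finset ι) (c : ι → ℂ)
    (a : ι → Module.End ℂ V) {d : Module.End ℂ V} (h : ∀ i, a i * d = d * a i) :
    (∑ i ∈ s, c i • a i) * d = d * ∑ i ∈ s, c i • a i := by
  rw [Finset.sum_mul, Finset.mul_sum]
  refine Finset.sum_congr rfl fun i _ => ?_
  rw [smul_mul_assoc, mul_smul_comm, h]

variable {n : ℕ}

/-! ### Oscillator relations on the Fock space -/

theorem bosCre_comm (s t : BosMode n) : bosCre s * bosCre t = bosCre t * bosCre s := by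
  rw [bosCre, bosCre, ← LinearMap.rTensor_mul, ← LinearMap.rTensor_mul]
  congr 1
  refine LinearMap.ext fun f => ?_
  simp [mul_left_comm]

theorem pderiv_comm {σ : Type*} (s t : σ) (f : MvPolynomial σ ℂ) :
    MvPolynomial.pderiv s (MvPolynomial.pderiv t f) =
      MvPolynomial.pderiv t (MvPolynomial.pderiv s f) := by
  classical
  induction f using MvPolynomial.induction_on with
  | C a => simp
  | add f g hf hg => simp [hf, hg]
  | mul_X f i hf =>
    simp only [MvPolynomial.pderiv_mul, map_add, hf, MvPolynomial.pderiv_X, Pi.single_apply]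
    split_ifs <;> simp
    ring

theorem bosAnn_comm (s t : BosMode n) : bosAnn s * bosAnn t = bosAnn t * bosAnn s := by
  rw [bosAnn, bosAnn, ← LinearMap.rTensor_mul, ← LinearMap.rTensor_mul]
  exact congrArg (LinearMap.rTensor _) (LinearMap.ext fun f => pderiv_comm s t f)

theorem bosAnn_bosCre_self (s : BosMode n) : bosAnn s * bosCre s = bosCre s * bosAnn s + 1 := by
  rw [bosAnn, bosCre, ← LinearMap.rTensor_mul, ← LinearMap.rTensor_mul,
    show (1 : Module.End ℂ (Fock n)) = LinearMap.rTensor _ 1 from (LinearMap.rTensor_id _ _).symm,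
    ← LinearMap.rTensor_add]
  congr 1
  refine LinearMap.ext fun f => ?_
  simp

theorem bosAnn_bosCre_of_ne {s t : BosMode n} (h : s ≠ t) :
    bosAnn s * bosCre t = bosCre t * bosAnn s := by
  rw [bosAnn, bosCre, ← LinearMap.rTensor_mul, ← LinearMap.rTensor_mul]
  congr 1
  refine LinearMap.ext fun f => ?_
  simp [MvPolynomial.pderiv_X_of_ne h.symm]

/-- Bosonic modes act on the polynomial factor and ghost modes on the exterior factor, so they
commute without signs. -/
theorem rTensor_lTensor_comm {M N : Type*} [AddCommGroup M] [Module ℂ M] [AddCommGroup N]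
    [Module ℂ N] (f : Module.End ℂ M) (g : Module.End ℂ N) :
    (LinearMap.rTensor N f : Module.End ℂ (M ⊗[ℂ] N)) * LinearMap.lTensor M g =
      LinearMap.lTensor M g * LinearMap.rTensor N f := by
  rw [Module.End.mul_eq_comp, Module.End.mul_eq_comp, LinearMap.rTensor_comp_lTensor,
    LinearMap.lTensor_comp_rTensor]

theorem ope_XY_self (i : Fin n) : HasOPE (fieldX i) (fieldY i) (oneField (Fock n)) 0 0 := by
  have key : ∀ (S : ℕ → BosMode n) (_ : Function.Injective S) (r s : ℕ), bosAnn (S r) *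
      bosCre (S s) = bosCre (S s) * bosAnn (S r) + if r = s then (1 : ℂ) • 1 else 0 :=
    fun S hS r s => by
      by_cases hrs : r = s
      · subst hrs
        rw [if_pos rfl, one_smul]
        exact bosAnn_bosCre_self _
      · rw [if_neg hrs, bosAnn_bosCre_of_ne fun h => hrs (hS h)]
        exact (add_zero _).symm
  refine (HasOPE.freeField 1 (fun r s => bosCre_comm _ _)
    (fun r s => (neg_mul_comm_of_comm (bosAnn_comm _ _)).symm)
    (key _ fun _ _ h => by cases h; rfl) fun r s => mul_neg_eq_add ?_).congr
    (one_smul _ _) rfl rfl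
  simpa only [eq_comm] using key (fun r => .X i r) (fun _ _ h => by cases h; rfl) s r

theorem commutes_XY {i j : Fin n} (h : i ≠ j) : Commutes (fieldX i) (fieldY j) :=
  commutes_freeField (fun _ _ => bosCre_comm _ _)
    (fun _ _ => (neg_mul_comm_of_comm (bosAnn_comm _ _)).symm)
    (fun _ _ => bosAnn_bosCre_of_ne (by simp [h]))
    fun _ _ => (neg_mul_comm_of_comm (bosAnn_bosCre_of_ne (by simp [h.symm]))).symm

theorem commutes_XX (i j : Fin n) : Commutes (fieldX i) (fieldX j) :=
  commutes_freeField (fun _ _ => bosCre_comm _ _) (fun _ _ => bosAnn_comm _ _)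
    (fun _ _ => bosAnn_bosCre_of_ne (by simp)) fun _ _ => (bosAnn_bosCre_of_ne (by simp)).symm

theorem commutes_YY (i j : Fin n) : Commutes (fieldY i) (fieldY j) :=
  commutes_freeField (fun _ _ => bosCre_comm _ _)
    (fun _ _ => neg_mul_comm_of_comm (neg_mul_comm_of_comm (bosAnn_comm _ _)).symm)
    (fun _ _ => neg_mul_comm_of_comm (bosAnn_bosCre_of_ne (by simp)))
    fun _ _ => (neg_mul_comm_of_comm (bosAnn_bosCre_of_ne (by simp))).symm

theorem heisAnn_mul_comm {d : Module.End ℂ (Fock n)}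
    (hd : ∀ b r, bosAnn (.h b r) * d = d * bosAnn (.h b r)) (a : Fin (n - 1)) (r : ℕ) :
    heisAnn a r * d = d * heisAnn a r := by
  cases r with
  | zero => exact (zero_mul d).trans (mul_zero d).symm
  | succ r => exact sum_smul_mul_comm _ _ _ fun b => hd b r

theorem commutes_HX (a : Fin (n - 1)) (i : Fin n) : Commutes (fieldH a) (fieldX i) :=
  commutes_freeField (fun _ _ => bosCre_comm _ _)
    (fun _ _ => heisAnn_mul_comm (fun _ _ => bosAnn_comm _ _) _ _)
    (fun _ _ => heisAnn_mul_comm (fun _ _ => bosAnn_bosCre_of_ne (by simp)) _ _)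
    fun _ _ => (bosAnn_bosCre_of_ne (by simp)).symm

theorem commutes_HY (a : Fin (n - 1)) (i : Fin n) : Commutes (fieldH a) (fieldY i) :=
  commutes_freeField (fun _ _ => bosCre_comm _ _)
    (fun _ _ => heisAnn_mul_comm (fun _ _ => (neg_mul_comm_of_comm (bosAnn_comm _ _)).symm) _ _)
    (fun _ _ => heisAnn_mul_comm (fun _ _ => bosAnn_bosCre_of_ne (by simp)) _ _)
    fun _ _ => (neg_mul_comm_of_comm (bosAnn_bosCre_of_ne (by simp))).symm

theorem commutes_XB (i : Fin n) (a : Fin (n - 1)) : Commutes (fieldX i) (fieldB a) :=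
  commutes_freeField (fun _ _ => rTensor_lTensor_comm _ _) (fun _ _ => rTensor_lTensor_comm _ _)
    (fun _ _ => rTensor_lTensor_comm _ _) (fun _ _ => rTensor_lTensor_comm _ _)

theorem commutes_XC (i : Fin n) (a : Fin (n - 1)) : Commutes (fieldX i) (fieldC a) :=
  commutes_freeField (fun _ _ => rTensor_lTensor_comm _ _) (fun _ _ => rTensor_lTensor_comm _ _)
    (fun _ _ => rTensor_lTensor_comm _ _) (fun _ _ => rTensor_lTensor_comm _ _)

theorem commutes_YB (i : Fin n) (a : Fin (n - 1)) : Commutes (fieldY i) (fieldB a) :=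
  commutes_freeField (fun _ _ => rTensor_lTensor_comm _ _)
    (fun _ _ => neg_mul_comm_of_comm (rTensor_lTensor_comm _ _))
    (fun _ _ => neg_mul_comm_of_comm (rTensor_lTensor_comm _ _)) (fun _ _ => rTensor_lTensor_comm _ _)

theorem commutes_YC (i : Fin n) (a : Fin (n - 1)) : Commutes (fieldY i) (fieldC a) :=
  commutes_freeField (fun _ _ => rTensor_lTensor_comm _ _)
    (fun _ _ => neg_mul_comm_of_comm (rTensor_lTensor_comm _ _))
    (fun _ _ => neg_mul_comm_of_comm (rTensor_lTensor_comm _ _)) (fun _ _ => rTensor_lTensor_comm _ _)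

end FreeFieldOPE

/-! ## A symplectic boson pair acting on an operator -/

section Pair

variable {V : Type*} [AddCommGroup V] [Module ℂ V]

/-- `D O = ((-(XY)) O) + (X (Y O)) + ((-(XY)) O)`. -/
noncomputable def pairD (X Y O : VertexOperator ℂ V) : VertexOperator ℂ V :=
  normal 0 0 (-normal 0 0 X Y) O + normal 0 0 X (normal 0 0 Y O) +
    normal 0 0 (-normal 0 0 X Y) O

variable {X Y T B C O E F : VertexOperator ℂ V} {s w : ℂ}

theorem pairD_smul (t : ℂ) (X Y O : VertexOperator ℂ V) :
    pairD X Y (t • O) = t • pairD X Y O := by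
  simp only [pairD, normal, nprod_smul_right]
  module

theorem pairD_add (X Y O P : VertexOperator ℂ V) :
    pairD X Y (O + P) = pairD X Y O + pairD X Y P := by
  simp only [pairD, normal, nprod_add_right]
  module

theorem pairD_neg (X Y O : VertexOperator ℂ V) : pairD X Y (-O) = -pairD X Y O := by
  simp only [pairD, normal, nprod_neg_right]
  module

theorem normal_pairD (hX : Commutes B X) (hY : Commutes B Y) (O : VertexOperator ℂ V) :
    normal 0 0 B (pairD X Y O) = pairD X Y (normal 0 0 B O) := by
  have hA : Commutes B (-normal 0 0 X Y) := (hX.nprod_right 0 0 (-1) hY).neg_right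
  have e : ∀ P Q : VertexOperator ℂ V,
      normal 0 0 B (P + Q) = normal 0 0 B P + normal 0 0 B Q := nprod_add_right 0 0 (-1) B
  rw [pairD, e, e, hA.left_comm, hX.left_comm, hY.left_comm, pairD]

theorem HasOPE.normal_right_of_commutes (hB : Commutes C B) (hO : HasOPE C O E 0 0) :
    HasOPE C (normal 0 0 B O) (normal 0 0 B E) 0 0 :=
  (hB.normal_right hO (HasOPE.zero_left O) (HasOPE.zero_left O)).congr
    (by simp only [normal, nprod_zero_left, zero_add])
    (by simp only [normal, nprod_zero_left, nprod_zero_right, zero_add])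
    (by simp only [normal, nprod_zero_right, zero_add, smul_zero])

theorem HasOPE.pairD_right (hX : Commutes B X) (hY : Commutes B Y) (hO : HasOPE B O E 0 0) :
    HasOPE B (pairD X Y O) (pairD X Y E) 0 0 := by
  have hA : Commutes B (-normal 0 0 X Y) := (hX.nprod_right 0 0 (-1) hY).neg_right
  have h₁ := HasOPE.normal_right_of_commutes hA hO
  have h₂ := HasOPE.normal_right_of_commutes hX (HasOPE.normal_right_of_commutes hY hO)
  exact ((h₁.add_right h₂).add_right h₁).congr rfl (by simp) (by simp)

theorem HasOPE.deriv_left_of_simple (h : HasOPE B C E 0 0) : HasOPE (deriv B) C 0 (-E) 0 :=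
  h.deriv_left.congr rfl rfl (smul_zero _)

theorem HasOPE.smul_left_of_simple (t : ℂ) (h : HasOPE B C E 0 0) :
    HasOPE (t • B) C (t • E) 0 0 :=
  (h.smul_left t).congr rfl (smul_zero _) (smul_zero _)

theorem Commutes.neg_left (h : Commutes B C) : Commutes (-B) C :=
  (HasOPE.neg_left h).congr neg_zero neg_zero neg_zero

/-- A symplectic boson pair `X(z)Y(w) ∼ 1/(z-w)`, primary of weight `1/2` for `T`. -/
structure IsSymplecticPair (T X Y : VertexOperator ℂ V) : Prop where
  XX : Commutes X X
  YY : Commutes Y Y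
  XY : HasOPE X Y (oneField V) 0 0
  TX : HasOPE T X (deriv X) ((1 / 2 : ℂ) • X) 0
  TY : HasOPE T Y (deriv Y) ((1 / 2 : ℂ) • Y) 0

namespace IsSymplecticPair

theorem YX (h : IsSymplecticPair T X Y) : HasOPE Y X (-oneField V) 0 0 :=
  h.XY.skew.congr (by rw [deriv_zero, zero_sub]) rfl rfl

/-- Wick's formula with the single field `X` on the left, followed by skew-symmetry. -/
theorem gauge_X (h : IsSymplecticPair T X Y) : HasOPE (-normal 0 0 X Y) X X 0 0 := by
  have h' : HasOPE X (normal 0 0 X Y) X 0 0 :=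
    (h.XX.normal_right h.XY (HasOPE.zero_left Y) (HasOPE.zero_left Y)).congr
      (by rw [normal_one]; simp only [normal, nprod_zero_left, zero_add])
      (by simp only [normal, nprod_zero_left, nprod_zero_right, zero_add])
      (by simp only [normal, nprod_zero_right, zero_add, smul_zero])
  exact h'.skew.neg_left.congr (by simp [deriv_zero]) neg_zero neg_zero

theorem gauge_Y (h : IsSymplecticPair T X Y) : HasOPE (-normal 0 0 X Y) Y (-Y) 0 0 := by
  have h' : HasOPE Y (normal 0 0 X Y) (-Y) 0 0 :=
    (h.YX.normal_right h.YY (Commutes.neg_left (HasOPE.one_left Y)) (HasOPE.zero_left Y)).congr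
      (by
        have := one_normal Y
        simp only [normal] at this ⊢
        rw [nprod_neg_left, this, nprod_zero_right, add_zero])
      (by simp only [normal, nprod_zero_left, nprod_zero_right, add_zero])
      (by simp only [normal, nprod_zero_right, add_zero, smul_zero])
  exact h'.skew.neg_left.congr (by simp [deriv_zero]) neg_zero neg_zero

/-- The simple poles cancel since `X` and `Y` have opposite charges; the double contraction leaves
the level `-1`. -/
theorem gauge_gauge (h : IsSymplecticPair T X Y) :
    HasOPE (-normal 0 0 X Y) (-normal 0 0 X Y) 0 (-oneField V) 0 :=
  (h.gauge_X.normal_right h.gauge_Y h.XY (HasOPE.zero_left Y)).neg_right.congr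
    (by simp only [normal, nprod_neg_right, add_neg_cancel, neg_zero])
    (by simp only [normal, nprod_zero_left, nprod_zero_right, add_zero])
    (by simp only [normal, nprod_zero_right, add_zero, smul_zero, neg_zero])

theorem stress_gauge (h : IsSymplecticPair T X Y) : HasOPE T (-normal 0 0 X Y)
    (deriv (-normal 0 0 X Y)) (-normal 0 0 X Y) 0 :=
  (h.TX.normal_right h.TY h.XY.deriv_left_of_simple (h.XY.smul_left_of_simple (1 / 2)) |>.neg_right).congr
    (by rw [deriv_neg, deriv_normal])
    (by
      simp only [normal, nprod_smul_left, nprod_smul_right]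
      module)
    (by
      simp only [normal, nprod_zero_right]
      module)

/-- OPEs of the fields of the pair with an operator, sufficient to control its `D`-image. -/
structure Acts (T X Y O E F : VertexOperator ℂ V) (s w : ℂ) : Prop where
  opeX : HasOPE X O E 0 0
  opeY : HasOPE Y O (-F) 0 0
  euler : normal 0 0 Y E + normal 0 0 X F = O
  charge : HasOPE (-normal 0 0 X Y) O (s • O) 0 0
  stress : HasOPE T O (deriv O) (w • O) 0

theorem X_YO (h : IsSymplecticPair T X Y) (hO : Acts T X Y O E F s w) :
    HasOPE X (normal 0 0 Y O) (O + normal 0 0 Y E) 0 0 :=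
  (h.XY.normal_right hO.opeX (HasOPE.one_left O) (HasOPE.zero_left O)).congr
    (by rw [one_normal])
    (by simp only [normal, nprod_zero_left, nprod_zero_right, add_zero])
    (by simp only [normal, nprod_zero_right, add_zero, smul_zero])

theorem gauge_YO (h : IsSymplecticPair T X Y) (hO : Acts T X Y O E F s w) :
    HasOPE (-normal 0 0 X Y) (normal 0 0 Y O) ((s - 1) • normal 0 0 Y O) F 0 :=
  (h.gauge_Y.normal_right hO.charge (hO.opeY.neg_left.congr (neg_neg F) neg_zero neg_zero)
    (HasOPE.zero_left O)).congr
    (by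
      simp only [normal, nprod_smul_right, nprod_neg_left]
      module)
    (by simp only [normal, nprod_zero_left, nprod_zero_right, add_zero])
    (by simp only [normal, nprod_zero_right, add_zero, smul_zero])

theorem gauge_XYO (h : IsSymplecticPair T X Y) (hO : Acts T X Y O E F s w) :
    HasOPE (-normal 0 0 X Y) (normal 0 0 X (normal 0 0 Y O))
      (s • normal 0 0 X (normal 0 0 Y O)) ((2 : ℂ) • O) 0 :=
  (h.gauge_X.normal_right (h.gauge_YO hO) (h.X_YO hO) (HasOPE.zero_left _)).congr
    (by
      simp only [normal, nprod_smul_right]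
      module)
    (by
      -- The double pole is `O + Y E` from `X` against `(Y O)`, plus `X F` from `(-(XY))` against
      -- `(Y O)`. The Euler relation makes the total `2 O`.
      rw [add_assoc, add_assoc, ← add_left_comm (normal 0 0 0 (normal 0 0 Y O)), hO.euler]
      simp only [normal, nprod_zero_left]
      module)
    (by simp only [normal, nprod_zero_right, add_zero, smul_zero])

theorem gauge_AO (h : IsSymplecticPair T X Y) (hO : Acts T X Y O E F s w) :
    HasOPE (-normal 0 0 X Y) (normal 0 0 (-normal 0 0 X Y) O)
      (s • normal 0 0 (-normal 0 0 X Y) O) (-O) 0 :=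
  (h.gauge_gauge.normal_right hO.charge (HasOPE.zero_left O) (Commutes.neg_left (HasOPE.one_left O))).congr
    (by simp only [normal, nprod_smul_right, nprod_zero_left, zero_add])
    (by
      have := one_normal O
      simp only [normal] at this ⊢
      rw [nprod_neg_left, this, nprod_zero_right, add_zero, zero_add])
    (by simp only [normal, nprod_zero_right, add_zero, smul_zero])

/-- The double poles are `-O`, `2 O` and `-O`. Their cancellation fixes the relative coefficient `2`
in `D`. -/
theorem gauge_pairD (h : IsSymplecticPair T X Y) (hO : Acts T X Y O E F s w) :
    HasOPE (-normal 0 0 X Y) (pairD X Y O) (s • pairD X Y O) 0 0 :=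
  (((h.gauge_AO hO).add_right (h.gauge_XYO hO)).add_right (h.gauge_AO hO)).congr
    (by rw [pairD]; module) (by module) (by module)

theorem stress_YO (h : IsSymplecticPair T X Y) (hO : Acts T X Y O E F s w) :
    HasOPE T (normal 0 0 Y O) (deriv (normal 0 0 Y O)) ((w + 1 / 2) • normal 0 0 Y O) 0 :=
  (h.TY.normal_right hO.stress hO.opeY.deriv_left_of_simple (hO.opeY.smul_left_of_simple (1 / 2))).congr
    (deriv_normal 0 0 Y O).symm
    (by
      simp only [normal, nprod_smul_left, nprod_smul_right]
      module)
    (by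
      simp only [normal, nprod_zero_right]
      module)

/-- No third-order pole appears: the contraction through `∂X` contributes `-(O + Y E)`, and twice
the one through `X / 2` contributes `O + Y E`. -/
theorem stress_XYO (h : IsSymplecticPair T X Y) (hO : Acts T X Y O E F s w) :
    HasOPE T (normal 0 0 X (normal 0 0 Y O)) (deriv (normal 0 0 X (normal 0 0 Y O)))
      ((w + 1) • normal 0 0 X (normal 0 0 Y O)) 0 :=
  (h.TX.normal_right (h.stress_YO hO) (h.X_YO hO).deriv_left_of_simple
    ((h.X_YO hO).smul_left_of_simple (1 / 2))).congr
    (deriv_normal 0 0 X _).symm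
    (by
      simp only [normal, nprod_smul_left, nprod_smul_right]
      module)
    (by
      simp only [normal, nprod_zero_right]
      module)

/-- Here the field `-(XY)` has weight `1` instead of `1/2`, so the contributions `-s O` and `2 s O`
leave the anomalous third-order pole `s O`. -/
theorem stress_AO (h : IsSymplecticPair T X Y) (hO : Acts T X Y O E F s w) :
    HasOPE T (normal 0 0 (-normal 0 0 X Y) O) (deriv (normal 0 0 (-normal 0 0 X Y) O))
      ((w + 1) • normal 0 0 (-normal 0 0 X Y) O) (s • O) :=
  (h.stress_gauge.normal_right hO.stress hO.charge.deriv_left_of_simple hO.charge).congr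
    (deriv_normal 0 0 _ O).symm
    (by
      simp only [normal, nprod_smul_right]
      module)
    (by
      simp only [normal, nprod_zero_right]
      module)

theorem stress_pairD (h : IsSymplecticPair T X Y) (hO : Acts T X Y O E F s w) :
    HasOPE T (pairD X Y O) (deriv (pairD X Y O)) ((w + 1) • pairD X Y O) ((2 * s) • O) :=
  (((h.stress_AO hO).add_right (h.stress_XYO hO)).add_right (h.stress_AO hO)).congr
    (by rw [pairD, deriv_add, deriv_add]) (by rw [pairD]; module) (by module)

end IsSymplecticPair

end Pair

/-! ## The BRST charge as a derivation -/

section Charge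

variable {V : Type*} [AddCommGroup V] [Module ℂ V]

/-- With `d` the zero mode of the BRST current, `C' = QC` and `[d, O] = 0`, this is the derivation
property `(QC)₍ₙ₎O = Q(C₍ₙ₎O)` for odd `C` and even closed `O`. -/
theorem nprod_anticommutator {d : Module.End ℂ V} {C C' O : VertexOperator ℂ V}
    (hC : ∀ m, mode C' m = d * mode C m + mode C m * d)
    (hO : ∀ m, d * mode O m = mode O m * d) (n m : ℤ) :
    mode (nprod 0 0 n C' O) m =
      d * mode (nprod 1 0 n C O) m + mode (nprod 1 0 n C O) m * d := by
  have hO' : ∀ m v, d (mode O m v) = mode O m (d v) := fun m v => LinearMap.congr_fun (hO m) v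
  refine LinearMap.ext fun v => ?_
  rw [LinearMap.add_apply, Module.End.mul_apply, Module.End.mul_apply, mode_nprod_apply,
    mode_nprod_apply, mode_nprod_apply, map_finsum d (hasFiniteSupport_prodTerm _ _ _ _ _ _),
    ← finsum_add_distrib]
  · refine finsum_congr fun j => ?_
    simp only [prodTerm, LinearMap.smul_apply, LinearMap.sub_apply, LinearMap.add_apply,
      Module.End.mul_apply, hC, map_sub, map_add, map_zsmul, hO', koszul, ZMod.val_zero, mul_zero,
      pow_zero, ← smul_add]
    congr 1
    simp only [smul_add]
    abel
  · exact (finite_support_prodTerm (koszul 1 0) C O n m v).subset fun j hj h =>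
      hj (by simp only [h, map_zero])
  · exact hasFiniteSupport_prodTerm _ _ _ _ _ _

theorem mode_nprod_one_one_zero (m : ℤ) (A B : VertexOperator ℂ V) :
    mode (nprod 1 1 0 A B) m = mode A 0 * mode B m + mode B m * mode A 0 := by
  rw [mode_nprod_zero, show koszul 1 1 = -1 from rfl, neg_one_smul, sub_neg_eq_add]

theorem mode_nprod_one_zero_zero (m : ℤ) (A B : VertexOperator ℂ V) :
    mode (nprod 1 0 0 A B) m = mode A 0 * mode B m - mode B m * mode A 0 := by
  rw [mode_nprod_zero, show koszul 1 0 = 1 from rfl, one_smul]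

theorem mode_mul_comm_of_nprod_eq_zero {A B : VertexOperator ℂ V} (h : nprod 1 0 0 A B = 0)
    (m : ℤ) : mode A 0 * mode B m = mode B m * mode A 0 := by
  rw [← sub_eq_zero, ← mode_nprod_one_zero_zero, h, mode_zero]

theorem Commutes.nprod_one_zero_eq_zero {A B : VertexOperator ℂ V} (h : Commutes B A) :
    nprod 1 0 0 A B = 0 :=
  field_ext fun m => by
    rw [mode_nprod_one_zero_zero, commutes_iff.1 h m 0, sub_self, mode_zero]

theorem smul_field_sub (t : ℂ) (A B : VertexOperator ℂ V) : t • A - t • B = t • (A - B) :=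
  (smul_sub t A B).symm

theorem sub_add_eq_neg_sub_neg_add (A B C : VertexOperator ℂ V) : A - B + C = -B - -A + C := by
  abel

end Charge

variable {n : ℕ}

/-! ### Passage to BRST classes -/

theorem nprod_brst {O : VertexOperator ℂ (Fock n)} (hO : brst 0 O = 0) (j : ℤ)
    (C : VertexOperator ℂ (Fock n)) :
    nprod 0 0 j (brst 1 C) O = brst 1 (nprod 1 0 j C O) := by
  refine field_ext fun m => ?_
  refine (nprod_anticommutator (mode_nprod_one_one_zero · (brstCurrent n) C)
    (mode_mul_comm_of_nprod_eq_zero hO) j m).trans ?_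
  exact (mode_nprod_one_one_zero m (brstCurrent n) _).symm

theorem isBRSTPrimary_of_isPrimary {w : ℂ} {O : VertexOperator ℂ (Fock n)}
    (hmem : IsOperator 0 O) (hQ : brst 0 O = 0) (h : IsPrimary (stressTensor n) w O) :
    IsBRSTPrimary n w O := by
  have key : ∀ (T' : VertexOperator ℂ (Fock n)), BRSTEquiv 0 T' (stressTensor n) → ∀ j : ℤ,
      BRSTEquiv 0 (nprod 0 0 j T' O) (nprod 0 0 j (stressTensor n) O) := by
    rintro T' ⟨C, hC, hT⟩ j
    -- If `T' - T = QC`, the OPE coefficients differ by `(QC)₍ⱼ₎O = Q(C₍ⱼ₎O)`.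
    refine ⟨nprod 1 0 j C O, hC.nprod j hmem, ?_⟩
    rw [← nprod_sub_left, hT]
    exact nprod_brst hQ j C
  exact ⟨hmem, hQ, fun T' _ hT => h.first_order ▸ key T' hT 0,
    fun T' _ hT => h.second_order ▸ key T' hT 1,
    fun T' _ hT j hj => h.higher_order j hj ▸ key T' hT j⟩

theorem HasOPE.isPrimary {T O : VertexOperator ℂ (Fock n)} {w : ℂ}
    (h : HasOPE T O (deriv O) (w • O) 0) : IsPrimary T w O := by
  refine ⟨h.nprod_zero, h.nprod_one, fun j hj => ?_⟩
  obtain ⟨j, rfl⟩ := Nat.exists_eq_add_of_le' hj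
  cases j with
  | zero => exact h.nprod_two
  | succ j => exact_mod_cast h.nprod_add_three j

/-! ## OPEs with the stress tensor -/

/-- Only the `i = j` summand of the symplectic boson part contributes; the Heisenberg and ghost
parts commute with `X_j`. Skew-symmetry later turns this into the weight `1/2` OPE of `T` with
`X_j`. -/
theorem ope_X_stressTensor (j : Fin n) : HasOPE (fieldX j) (stressTensor n)
    (-((1 / 2 : ℂ) • deriv (fieldX j))) ((1 / 2 : ℂ) • fieldX j) 0 := by
  classical
  have hSB : ∀ i, HasOPE (fieldX j) (normal 0 0 (fieldX i) (deriv (fieldY i)) -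
      normal 0 0 (deriv (fieldX i)) (fieldY i))
      (if j = i then -deriv (fieldX i) else 0) (if j = i then fieldX i else 0) 0 := fun i => by
    by_cases hij : j = i
    · subst hij
      rw [if_pos rfl, if_pos rfl]
      have h₁ := (commutes_XX j j).normal_right ((ope_XY_self j).deriv_right.congr
        deriv_oneField rfl rfl) (HasOPE.zero_left _) (HasOPE.zero_left _)
      have h₂ := HasOPE.normal_right_of_commutes (commutes_XX j j).deriv_right (ope_XY_self j)
      refine (h₁.sub_right h₂).congr ?_ ?_ ?_
      · rw [normal_one]
        simp only [normal, nprod_zero_left, nprod_zero_right, zero_add, zero_sub]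
      · rw [normal_one]
        simp only [normal, nprod_zero_left, zero_add, sub_zero]
      · simp only [normal, nprod_zero_right, smul_zero, zero_add, sub_zero]
    · rw [if_neg hij, if_neg hij]
      exact ((commutes_XX j i).nprod_right 0 0 (-1) (commutes_XY hij).deriv_right).sub_right
        ((commutes_XX j i).deriv_right.nprod_right 0 0 (-1) (commutes_XY hij))
  have hH : Commutes (fieldX j) (stressH n) :=
    Commutes.smul_right _ <| Commutes.sum_right _ fun a _ => Commutes.sum_right _ fun b _ =>
      ((commutes_HX a j).symm.nprod_right 0 0 (-1) (commutes_HX b j).symm).smul_right _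
  have hBC : Commutes (fieldX j) (stressBC n) :=
    (Commutes.sum_right _ fun a _ =>
      (commutes_XB j a).nprod_right 1 1 (-1) (commutes_XC j a).deriv_right).neg_right
  refine ((((HasOPE.sum_right Finset.univ fun i _ => hSB i).smul_right (1 / 2)).add_right
    hH).add_right hBC).congr ?_ ?_ ?_ <;> simp

theorem ope_Y_stressTensor (j : Fin n) : HasOPE (fieldY j) (stressTensor n)
    (-((1 / 2 : ℂ) • deriv (fieldY j))) ((1 / 2 : ℂ) • fieldY j) 0 := by
  classical
  have hYX : HasOPE (fieldY j) (fieldX j) (-oneField (Fock n)) 0 0 :=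
    (ope_XY_self j).skew.congr (by rw [deriv_zero, zero_sub]) rfl rfl
  have neg_one_normal : ∀ A : VertexOperator ℂ (Fock n),
      normal 0 0 (-oneField (Fock n)) A = -A := fun A => by
    rw [show normal 0 0 (-oneField (Fock n)) A = -normal 0 0 (oneField (Fock n)) A from
      nprod_neg_left _ _ _ _ _, one_normal]
  have hSB : ∀ i, HasOPE (fieldY j) (normal 0 0 (fieldX i) (deriv (fieldY i)) -
      normal 0 0 (deriv (fieldX i)) (fieldY i))
      (if j = i then -deriv (fieldY i) else 0) (if j = i then fieldY i else 0) 0 := fun i => by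
    by_cases hij : j = i
    · subst hij
      rw [if_pos rfl, if_pos rfl]
      have h₁ := hYX.normal_right (commutes_YY j j).deriv_right
        (Commutes.neg_left (HasOPE.one_left _)) (HasOPE.zero_left _)
      have h₂ := (hYX.deriv_right.congr (by rw [deriv_neg, deriv_oneField, neg_zero]) rfl
        rfl).normal_right (commutes_YY j j) (HasOPE.zero_left _)
        (Commutes.neg_left (HasOPE.one_left _))
      refine (h₁.sub_right h₂).congr ?_ ?_ ?_
      · rw [neg_one_normal]
        simp only [normal, nprod_zero_left, nprod_zero_right, add_zero, sub_zero]
      · rw [neg_one_normal]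
        simp only [normal, nprod_zero_left, nprod_zero_right, zero_add, add_zero, zero_sub,
          neg_neg]
      · simp only [normal, nprod_zero_right, smul_zero, zero_add, sub_zero]
    · rw [if_neg hij, if_neg hij]
      have hc := (commutes_XY (Ne.symm hij)).symm
      exact (hc.nprod_right 0 0 (-1) (commutes_YY j i).deriv_right).sub_right
        (hc.deriv_right.nprod_right 0 0 (-1) (commutes_YY j i))
  have hH : Commutes (fieldY j) (stressH n) :=
    Commutes.smul_right _ <| Commutes.sum_right _ fun a _ => Commutes.sum_right _ fun b _ =>
      ((commutes_HY a j).symm.nprod_right 0 0 (-1) (commutes_HY b j).symm).smul_right _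
  have hBC : Commutes (fieldY j) (stressBC n) :=
    (Commutes.sum_right _ fun a _ =>
      (commutes_YB j a).nprod_right 1 1 (-1) (commutes_YC j a).deriv_right).neg_right
  refine ((((HasOPE.sum_right Finset.univ fun i _ => hSB i).smul_right (1 / 2)).add_right
    hH).add_right hBC).congr ?_ ?_ ?_ <;> simp

theorem isSymplecticPair (j : Fin n) :
    IsSymplecticPair (stressTensor n) (fieldX j) (fieldY j) where
  XX := commutes_XX j j
  YY := commutes_YY j j
  XY := ope_XY_self j
  TX := (ope_X_stressTensor j).skew.congr (by rw [deriv_smul]; module) rfl rfl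
  TY := (ope_Y_stressTensor j).skew.congr (by rw [deriv_smul]; module) rfl rfl

theorem covD_eq_pairD (i : Fin n) (O : VertexOperator ℂ (Fock n)) :
    covD i O = pairD (fieldX i) (fieldY i) O := rfl

theorem commutes_gaugeA_X {l i : Fin n} (h : l ≠ i) : Commutes (gaugeA l) (fieldX i) :=
  ((commutes_XX i l).nprod_right 0 0 (-1) (commutes_XY h.symm)).neg_right.symm

theorem commutes_gaugeA_Y {l i : Fin n} (h : l ≠ i) : Commutes (gaugeA l) (fieldY i) :=
  ((commutes_XY h).symm.nprod_right 0 0 (-1) (commutes_YY i l)).neg_right.symm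

/-! ## Operators on which the `D_i` act -/

/-- An operator of charge `s` under each `𝒜_l` and weight `w`, on which the symplectic bosons with
index in `S` act as on `𝒳` or `𝒴`. -/
structure IsCharged (s w : ℂ) (S : Set (Fin n)) (O : VertexOperator ℂ (Fock n)) : Prop where
  mem : IsOperator 0 O
  pair : ∀ l ∈ S, ∃ E F, HasOPE (fieldX l) O E 0 0 ∧ HasOPE (fieldY l) O (-F) 0 0 ∧
    normal 0 0 (fieldY l) E + normal 0 0 (fieldX l) F = O
  charge : ∀ l, HasOPE (gaugeA l) O (s • O) 0 0
  heis : ∀ a, Commutes (fieldH a) O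
  ghost : ∀ a, Commutes (fieldC a) O
  stress : HasOPE (stressTensor n) O (deriv O) (w • O) 0

namespace IsCharged

variable {s w : ℂ} {S S' : Set (Fin n)} {O P : VertexOperator ℂ (Fock n)}

theorem mono (h : IsCharged s w S O) (hS : S' ⊆ S) : IsCharged s w S' O :=
  { h with pair := fun l hl => h.pair l (hS hl) }

theorem acts (h : IsCharged s w S O) {l : Fin n} (hl : l ∈ S) : ∃ E F,
    IsSymplecticPair.Acts (stressTensor n) (fieldX l) (fieldY l) O E F s w := by
  obtain ⟨E, F, hE, hF, hEF⟩ := h.pair l hl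
  exact ⟨E, F, hE, hF, hEF, h.charge l, h.stress⟩

theorem isOperator_covD (hO : IsOperator 0 O) (i : Fin n) : IsOperator 0 (covD i O) := by
  have hA : IsOperator 0 (gaugeA i) := by
    have := ((IsOperator.X i).nprod (-1) (IsOperator.Y i)).smul (-1)
    rwa [← neg_eq_smul] at this
  have hAO : IsOperator 0 (normal 0 0 (gaugeA i) O) := hA.nprod (-1) hO
  have hXYO : IsOperator 0 (normal 0 0 (fieldX i) (normal 0 0 (fieldY i) O)) :=
    (IsOperator.X i).nprod (-1) ((IsOperator.Y i).nprod (-1) hO)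
  exact (hAO.add hXYO).add hAO

theorem charge_covD (h : IsCharged s w S O) {i : Fin n} (hi : i ∈ S) (l : Fin n) :
    HasOPE (gaugeA l) (covD i O) (s • covD i O) 0 0 := by
  rcases eq_or_ne l i with rfl | hl
  · obtain ⟨E, F, hO⟩ := h.acts hi
    exact (isSymplecticPair l).gauge_pairD hO
  · exact (HasOPE.pairD_right (commutes_gaugeA_X hl) (commutes_gaugeA_Y hl) (h.charge l)).congr
      (pairD_smul _ _ _ _) rfl rfl

theorem commutes_covD {B : VertexOperator ℂ (Fock n)} {i : Fin n} (hX : Commutes B (fieldX i))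
    (hY : Commutes B (fieldY i)) (hO : Commutes B O) : Commutes B (covD i O) :=
  (HasOPE.pairD_right hX hY hO).congr
    (by simpa using pairD_smul 0 (fieldX i) (fieldY i) 0) rfl rfl

/-- For `l ≠ i`, both `X_l` and `Y_l` commute with the pair `i`, hence pass through the linear map
`D_i`, which carries the Euler relation along. -/
theorem pair_covD {i l : Fin n} (hl : l ≠ i) {E F : VertexOperator ℂ (Fock n)}
    (hE : HasOPE (fieldX l) O E 0 0) (hF : HasOPE (fieldY l) O (-F) 0 0)
    (hEF : normal 0 0 (fieldY l) E + normal 0 0 (fieldX l) F = O) :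
    HasOPE (fieldX l) (covD i O) (covD i E) 0 0 ∧ HasOPE (fieldY l) (covD i O) (-covD i F) 0 0 ∧
      normal 0 0 (fieldY l) (covD i E) + normal 0 0 (fieldX l) (covD i F) = covD i O := by
  have h₁ := commutes_XX l i
  have h₂ := commutes_XY hl
  have h₃ := (commutes_XY hl.symm).symm
  have h₄ := commutes_YY l i
  refine ⟨HasOPE.pairD_right h₁ h₂ hE,
    (HasOPE.pairD_right h₃ h₄ hF).congr (pairD_neg _ _ _) rfl rfl, ?_⟩
  rw [covD_eq_pairD, covD_eq_pairD, normal_pairD h₃ h₄, normal_pairD h₁ h₂, ← pairD_add, hEF,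
    covD_eq_pairD]

theorem covD_sub_covD (h : IsCharged s w S O) {i j : Fin n} (hi : i ∈ S) (hj : j ∈ S) :
    IsCharged s (w + 1) {l ∈ S | l ≠ i ∧ l ≠ j} ((covD i - covD j) O) where
  mem := by
    have := (isOperator_covD h.mem i).add ((isOperator_covD h.mem j).smul (-1))
    rwa [← neg_eq_smul, ← sub_eq_add_neg] at this
  pair l hl := by
    obtain ⟨hl, hli, hlj⟩ := hl
    obtain ⟨E, F, hE, hF, hEF⟩ := h.pair l hl
    obtain ⟨hE₁, hF₁, h₁⟩ := pair_covD hli hE hF hEF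
    obtain ⟨hE₂, hF₂, h₂⟩ := pair_covD hlj hE hF hEF
    refine ⟨covD i E - covD j E, covD i F - covD j F,
      (hE₁.sub_right hE₂).congr rfl (sub_zero _) (sub_zero _),
      (hF₁.sub_right hF₂).congr (by abel) (sub_zero _) (sub_zero _), ?_⟩
    rw [Pi.sub_apply, ← h₁, ← h₂]
    simp only [normal, nprod_sub_right]
    abel
  charge l := ((h.charge_covD hi l).sub_right (h.charge_covD hj l)).congr
    (smul_field_sub _ _ _) (sub_zero _) (sub_zero _)
  heis a := (commutes_covD (commutes_HX a i) (commutes_HY a i) (h.heis a)).sub_right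
    (commutes_covD (commutes_HX a j) (commutes_HY a j) (h.heis a))
  ghost a := (commutes_covD (commutes_XC i a).symm (commutes_YC i a).symm (h.ghost a)).sub_right
    (commutes_covD (commutes_XC j a).symm (commutes_YC j a).symm (h.ghost a))
  stress := by
    obtain ⟨E, F, hOi⟩ := h.acts hi
    obtain ⟨E', F', hOj⟩ := h.acts hj
    -- Both third-order poles equal `2 s O`, and the difference removes them.
    exact (((isSymplecticPair i).stress_pairD hOi).sub_right
      ((isSymplecticPair j).stress_pairD hOj)).congr (deriv_sub _ _).symm
      (smul_field_sub _ _ _) (sub_self _)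

/-! ### Induction over the pairs of indices -/

theorem foldr_ofFn_pairs {α β : Type*} (G : α → α → β → β) {k : ℕ} (i : Fin (2 * (k + 1)) → α)
    (O : β) :
    (List.ofFn fun j : Fin (k + 1) => G (i ⟨2 * j.val, by omega⟩)
      (i ⟨2 * j.val + 1, by omega⟩)).foldr (fun D P => D P) O =
    G (i ⟨0, by omega⟩) (i ⟨1, by omega⟩) ((List.ofFn fun j : Fin k =>
      G (i ⟨2 * j.val + 2, by omega⟩) (i ⟨2 * j.val + 1 + 2, by omega⟩)).foldr
        (fun D P => D P) O) := by
  have h : ∀ j : Fin k, G (i ⟨2 * j.succ.val, by omega⟩) (i ⟨2 * j.succ.val + 1, by omega⟩) =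
      G (i ⟨2 * j.val + 2, by omega⟩) (i ⟨2 * j.val + 1 + 2, by omega⟩) := fun j =>
    congrArg₂ (fun a b => G (i a) (i b)) (Fin.ext (by simp only [Fin.val_succ]; omega))
      (Fin.ext (by simp only [Fin.val_succ]; omega))
  simp only [List.ofFn_succ, List.foldr_cons, h]
  exact congrArg₂ (fun a b => G (i a) (i b) _) (Fin.ext (by simp)) (Fin.ext (by simp))

theorem diffProd_succ {k : ℕ} (i : Fin (2 * (k + 1)) → Fin n) (O : VertexOperator ℂ (Fock n)) :
    BosonicVOA.diffProd i O = (covD (i ⟨0, by omega⟩) - covD (i ⟨1, by omega⟩))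
      (BosonicVOA.diffProd (fun m : Fin (2 * k) => i ⟨m + 2, by omega⟩) O) := by
  have h := foldr_ofFn_pairs (fun a b => covD a - covD b) i O
  have h' : BosonicVOA.diffProd (fun m : Fin (2 * k) => i ⟨m + 2, by omega⟩) O =
      (List.ofFn fun j : Fin k => covD (i ⟨2 * j.val + 2, by omega⟩) -
        covD (i ⟨2 * j.val + 1 + 2, by omega⟩)).foldr (fun D P => D P) O := by
    rw [BosonicVOA.diffProd]
  rw [h', BosonicVOA.diffProd]
  exact h

theorem diffProd (h : IsCharged s w Set.univ O) {k : ℕ} (i : Fin (2 * k) → Fin n)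
    (hi : Function.Injective i) :
    IsCharged s (w + k) {l | ∀ m, i m ≠ l} (diffProd i O) := by
  induction k with
  | zero =>
    have e : BosonicVOA.diffProd i O = O := by simp [BosonicVOA.diffProd]
    rw [e, Nat.cast_zero, add_zero]
    exact h.mono (Set.subset_univ _)
  | succ k ih =>
    -- Dropping the first two indices leaves the factors applied earlier. The pair `i 0`, `i 1` acts
    -- last, and by injectivity its indices are still available.
    let i' : Fin (2 * k) → Fin n := fun m => i ⟨m + 2, by omega⟩
    have hi' : Function.Injective i' := fun a b hab => by
      have := hi hab
      simp only [Fin.mk.injEq] at this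
      omega
    have h₀ : ∀ m, i' m ≠ i ⟨0, by omega⟩ := fun m hm => by
      have := congrArg Fin.val (hi hm)
      simp at this
    have h₁ : ∀ m, i' m ≠ i ⟨1, by omega⟩ := fun m hm => by
      have := congrArg Fin.val (hi hm)
      simp at this
    rw [diffProd_succ, Nat.cast_succ, ← add_assoc]
    refine ((ih i' hi').covD_sub_covD h₀ h₁).mono fun l hl => ?_
    exact ⟨fun m => hl _, (hl _).symm, (hl _).symm⟩

theorem brst_eq_zero (h : IsCharged s w S O) : brst 0 O = 0 := by
  have hJ : Commutes O (brstCurrent n) := Commutes.sum_right _ fun a _ => by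
    refine (h.ghost a).symm.nprod_right 1 0 (-1) ?_
    -- Neighbouring charges are equal, so the simple poles of `A_{a+1}` and `A_a` with `O` cancel.
    have h₁ := ((h.charge (right a)).sub_left (h.charge (left a))).congr (sub_self _)
      (sub_zero _) (sub_zero _)
    have h₂ := (h₁.add_left (h.heis a)).congr (add_zero _) (add_zero _) (add_zero _)
    have e : normal 0 0 (fieldX (left a)) (fieldY (left a)) -
        normal 0 0 (fieldX (right a)) (fieldY (right a)) + fieldH a =
        gaugeA (right a) - gaugeA (left a) + fieldH a := sub_add_eq_neg_sub_neg_add _ _ _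
    rw [e]
    exact Commutes.symm h₂
  exact hJ.nprod_one_zero_eq_zero

end IsCharged

/-! ## The operators `𝒳` and `𝒴` -/

section Seeds

variable {n : ℕ}

/-- The nested normally ordered product of the fields `Z i` for `i` in a list. -/
noncomputable def listProd (Z : Fin n → VertexOperator ℂ (Fock n)) (L : List (Fin n)) :
    VertexOperator ℂ (Fock n) :=
  L.foldr (fun i O => normal 0 0 (Z i) O) (oneField (Fock n))

variable {Z W : Fin n → VertexOperator ℂ (Fock n)} {B T : VertexOperator ℂ (Fock n)}

theorem isOperator_listProd (hZ : ∀ i, IsOperator 0 (Z i)) (L : List (Fin n)) :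
    IsOperator 0 (listProd Z L) := by
  induction L with
  | nil => exact IsOperator.one
  | cons i L ih => exact (hZ i).nprod (-1) ih

theorem commutes_listProd (hZ : ∀ i, Commutes B (Z i)) (L : List (Fin n)) :
    Commutes B (listProd Z L) := by
  induction L with
  | nil => exact HasOPE.one_right B
  | cons i L ih => exact (hZ i).nprod_right 0 0 (-1) ih

theorem stress_listProd (hZZ : ∀ i j, Commutes (Z i) (Z j))
    (hT : ∀ i, HasOPE T (Z i) (deriv (Z i)) ((1 / 2 : ℂ) • Z i) 0) (L : List (Fin n)) :
    HasOPE T (listProd Z L) (deriv (listProd Z L)) ((L.length / 2 : ℂ) • listProd Z L) 0 := by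
  induction L with
  | nil =>
    refine (HasOPE.one_right T).congr deriv_oneField.symm ?_ rfl
    simp
  | cons i L ih =>
    have hc := commutes_listProd (hZZ i) L
    refine ((hT i).normal_right ih (hc.deriv_left_of_simple.congr rfl neg_zero rfl)
      (hc.smul_left_of_simple (1 / 2) |>.congr (smul_zero _) rfl rfl)).congr
      (deriv_normal 0 0 _ _).symm ?_ ?_
    · rw [List.length_cons, Nat.cast_succ]
      simp only [normal, nprod_smul_left, nprod_smul_right, listProd, List.foldr_cons]
      module
    · simp only [normal, nprod_zero_right, smul_zero, add_zero]

theorem charge_listProd {l : Fin n} {s : ℂ} (hZZ : ∀ i j, Commutes (Z i) (Z j))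
    (hB : HasOPE B (Z l) (s • Z l) 0 0) (hB' : ∀ i, l ≠ i → Commutes B (Z i))
    (L : List (Fin n)) :
    HasOPE B (listProd Z L) ((L.count l * s : ℂ) • listProd Z L) 0 0 := by
  induction L with
  | nil => exact (HasOPE.one_right B).congr (by simp) rfl rfl
  | cons i L ih =>
    rcases eq_or_ne l i with rfl | hl
    · refine (hB.normal_right ih ((commutes_listProd (hZZ l) L).smul_left_of_simple s |>.congr
        (smul_zero _) rfl rfl) (HasOPE.zero_left _)).congr ?_ ?_ ?_
      · rw [List.count_cons_self, Nat.cast_succ]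
        simp only [normal, nprod_smul_left, nprod_smul_right, listProd, List.foldr_cons]
        module
      · simp only [normal, nprod_zero_left, nprod_zero_right, add_zero]
      · simp only [normal, nprod_zero_right, smul_zero, add_zero]
    · rw [List.count_cons_of_ne hl.symm]
      exact (HasOPE.normal_right_of_commutes (hB' i hl) ih).congr
        (nprod_smul_right 0 0 (-1) _ _ _) rfl rfl

/-- The OPE of a field conjugate to `Z l` with a product of the `Z i`. -/
theorem conjugate_listProd {l : Fin n} {t : ℂ} (hZZ : ∀ i j, Commutes (Z i) (Z j))
    (hB : HasOPE B (Z l) (t • oneField (Fock n)) 0 0) (hB' : ∀ i, l ≠ i → Commutes B (Z i))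
    (L : List (Fin n)) :
    ∃ F, HasOPE B (listProd Z L) (t • F) 0 0 ∧
      normal 0 0 (Z l) F = (L.count l : ℂ) • listProd Z L := by
  induction L with
  | nil =>
    refine ⟨0, (HasOPE.one_right B).congr (smul_zero t).symm rfl rfl, ?_⟩
    simp only [normal, nprod_zero_right, List.count_nil, Nat.cast_zero]
    simp
  | cons i L ih =>
    obtain ⟨F, hF, hZF⟩ := ih
    have hF' : normal 0 0 (Z l) (normal 0 0 (Z i) F) = (L.count l : ℂ) • listProd Z (i :: L) := by
      rw [(hZZ l i).left_comm, hZF]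
      exact nprod_smul_right _ _ _ _ _ _
    rcases eq_or_ne l i with rfl | hl
    -- Leibniz rule: `F` plays the role of the derivative of the product with respect to `Z l`, and
    -- `Z l F` counts the occurrences of `l`.
    · refine ⟨listProd Z L + normal 0 0 (Z l) F, (hB.normal_right hF
        ((HasOPE.one_left (listProd Z L)).smul_left_of_simple t |>.congr (smul_zero _) rfl rfl)
        (HasOPE.zero_left _)).congr ?_ ?_ ?_, ?_⟩
      · have := one_normal (listProd Z L)
        simp only [normal] at this ⊢
        rw [nprod_smul_left, this, nprod_smul_right, smul_add]
      · simp only [normal, nprod_zero_left, nprod_zero_right, add_zero]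
      · simp only [normal, nprod_zero_right, smul_zero, add_zero]
      · rw [List.count_cons_self, Nat.cast_succ, show normal 0 0 (Z l) (listProd Z L +
          normal 0 0 (Z l) F) = normal 0 0 (Z l) (listProd Z L) + normal 0 0 (Z l)
          (normal 0 0 (Z l) F) from nprod_add_right _ _ _ _ _ _, hF']
        simp only [listProd, List.foldr_cons]
        module
    · refine ⟨normal 0 0 (Z i) F, (HasOPE.normal_right_of_commutes (hB' i hl) hF).congr
        (nprod_smul_right 0 0 (-1) _ _ _) rfl rfl, ?_⟩
      rw [List.count_cons_of_ne hl.symm, hF']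

theorem nestedProd_eq_listProd (Z : Fin n → VertexOperator ℂ (Fock n)) :
    nestedProd Z = listProd Z (List.finRange n) := by
  rw [nestedProd, listProd, List.ofFn_eq_map, List.foldr_map]

theorem isCharged_calX : IsCharged 1 (n / 2 : ℂ) Set.univ (calX n) := by
  have hcount : ∀ l : Fin n, (List.finRange n).count l = 1 := fun l =>
    List.count_eq_one_of_mem (List.nodup_finRange n) (List.mem_finRange l)
  rw [calX, nestedProd_eq_listProd]
  refine ⟨isOperator_listProd IsOperator.X _, fun l _ => ?_, fun l => ?_,
    fun a => commutes_listProd (commutes_HX a) _,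
    fun a => commutes_listProd (fun i => (commutes_XC i a).symm) _, ?_⟩
  · obtain ⟨F, hF, hXF⟩ := conjugate_listProd commutes_XX
      ((isSymplecticPair l).YX.congr (neg_eq_smul _) rfl rfl)
      (fun i hi => (commutes_XY (Ne.symm hi)).symm) (List.finRange n)
    -- `X_l` commutes with `𝒳`, so `E = 0`. The Euler relation reduces to `X_l F = 𝒳`, as `l` occurs
    -- exactly once.
    refine ⟨0, F, commutes_listProd (commutes_XX l) _, hF.congr (neg_eq_smul _).symm rfl rfl, ?_⟩
    rw [hXF, hcount, Nat.cast_one]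
    simp only [normal, nprod_zero_right]
    module
  · exact (charge_listProd commutes_XX ((isSymplecticPair l).gauge_X.congr
      (one_smul ℂ _).symm rfl rfl) (fun i hi => commutes_gaugeA_X hi) _).congr
      (by rw [hcount, Nat.cast_one, one_mul]) rfl rfl
  · exact (stress_listProd commutes_XX (fun i => (isSymplecticPair i).TX) _).congr rfl
      (by rw [List.length_finRange]) rfl

theorem isCharged_calY : IsCharged (-1) (n / 2 : ℂ) Set.univ (calY n) := by
  have hcount : ∀ l : Fin n, (List.finRange n).count l = 1 := fun l =>
    List.count_eq_one_of_mem (List.nodup_finRange n) (List.mem_finRange l)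
  rw [calY, nestedProd_eq_listProd]
  refine ⟨isOperator_listProd IsOperator.Y _, fun l _ => ?_, fun l => ?_,
    fun a => commutes_listProd (commutes_HY a) _,
    fun a => commutes_listProd (fun i => (commutes_YC i a).symm) _, ?_⟩
  · obtain ⟨E, hE, hYE⟩ := conjugate_listProd commutes_YY
      ((ope_XY_self l).congr (one_smul ℂ _).symm rfl rfl)
      (fun i hi => commutes_XY hi) (List.finRange n)
    -- The roles of `X` and `Y` are exchanged: `F = 0` and `Y_l E = 𝒴`.
    refine ⟨E, 0, hE.congr (one_smul ℂ _) rfl rfl,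
      (commutes_listProd (commutes_YY l) _).congr neg_zero.symm rfl rfl, ?_⟩
    rw [hYE, hcount, Nat.cast_one]
    simp only [normal, nprod_zero_right]
    module
  · exact (charge_listProd commutes_YY ((isSymplecticPair l).gauge_Y.congr
      (neg_eq_smul _) rfl rfl) (fun i hi => commutes_gaugeA_Y hi) _).congr
      (by rw [hcount, Nat.cast_one, one_mul]) rfl rfl
  · exact (stress_listProd commutes_YY (fun i => (isSymplecticPair i).TY) _).congr rfl
      (by rw [List.length_finRange]) rfl

theorem IsCharged.isPrimary_and_isBRSTPrimary {s w : ℂ} {S : Set (Fin n)}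
    {O : VertexOperator ℂ (Fock n)} (h : IsCharged s w S O) :
    IsPrimary (stressTensor n) w O ∧ IsBRSTPrimary n w O :=
  ⟨h.stress.isPrimary, isBRSTPrimary_of_isPrimary h.mem h.brst_eq_zero h.stress.isPrimary⟩

end Seeds

end BosonicVOA

open BosonicVOA in
theorem mainTheorem5 (n k : ℕ) (hkn : 2 * k ≤ n) (i : Fin (2 * k) → Fin n)
    (hi : Function.Injective i) :
    (IsPrimary (stressTensor n) ((n : ℂ) / 2 + k) (diffProd i (calX n)) ∧
      IsBRSTPrimary n ((n : ℂ) / 2 + k) (diffProd i (calX n))) ∧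
    (IsPrimary (stressTensor n) ((n : ℂ) / 2 + k) (diffProd i (calY n)) ∧
      IsBRSTPrimary n ((n : ℂ) / 2 + k) (diffProd i (calY n))) :=
  ⟨(isCharged_calX.diffProd i hi).isPrimary_and_isBRSTPrimary,
    (isCharged_calY.diffProd i hi).isPrimary_and_isBRSTPrimary⟩
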